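/- **Setting.** Let $\mathcal P$ be the path algebra over a field $K$ of a finite quiver; $\mathrm{Mon}(\mathcal P)$ is its set of monomials, i.e. directed paths, including the trivial paths $1_v$ at the vertices $v$, and multiplication is concatenation (or $0$ for non-composable paths). A *monomial ordering* of $\mathcal P$ is a total ordering $>$ of $\mathrm{Mon}(\mathcal P)$ such that $b_1>b_2$ implies $b_1b>b_2b$ and $b'b_1>b'b_2$ whenever these four products are non-zero. Fix one; leading monomials $\mathrm{LM}$ are taken with respect to it. Let $\psi:\mathcal P\to\mathcal A$ be a quotient algebra. A path is *standard* if it is not the leading monomial of an element of $\ker\psi$; the images in $\mathcal A$ of the standard paths are the *monomials* of $\mathcal A$, and we denote their set by $\mathcal B$, the standard path above $b\in\mathcal B$ by $\lambda(b)$, and put $b>b'$ iff $\lambda(b)>\lambda(b')$. Assume that $\mathcal B$ is a $K$-basis of $\mathcal A$ and that the ordering is admissible: $\mathcal B$ contains no infinite strictly decreasing sequence. Leading monomials in $\mathcal A$ are defined through the basis $\mathcal B$. For $b,c\in\mathcal B$ and $t\in\mathcal B\cup\{0\}$, $t$ is a *toppling* of $b$ with *cofactor* $c$ if either $\mathrm{LM}(bc)=t\neq0$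 and $\lambda(b)\lambda(c)\neq\lambda(t)$, or $bc=0=t$. If $c$ is not a cofactor of a toppling of $b$, it is a *small cofactor* of $b$ (then $\lambda(b)\lambda(c)=\lambda(bc)$ is standard). A toppling of $b$ with cofactor $c$ is *minimal* if every $c'\in\mathcal B$ with $c'\neq c$ such that $\lambda(c')$ is an initial segment of $\lambda(c)$ is a small cofactor of $b$. Let $F=\mathcal A^r$ be the free right $\mathcal A$-module with generators $\mathfrak v_1,\dots,\mathfrak v_r$; its monomials are the $\mathfrak v_ib$ with $b\in\mathcal B$. Fix a total ordering of them compatible with the one on $\mathcal A$: $b_1>b_2$ implies $\mathfrak v_ib_1>\mathfrak v_ib_2$, and $\mathfrak v_ib_1>\mathfrak v_jb_2$ implies $\mathfrak v_ib_1b>\mathfrak v_j\mathrm{LM}(b_2b)$ or $b_2b=0$ whenever $b$ is a small cofactor of $b_1$. If $\mathrm{LM}(f)=\mathfrak v_ib$, a small cofactor of $\mathrm{LM}(f)$ means a small cofactor of $b$. Let $\hat g_1,\dots,\hat g_m\in F$ generate the right $\mathcal A$-submodule $M\subseteq F$, let $E=\mathcal P^m$ be the free right $\mathcal P$-module with generators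 $\mathfrak e_1,\dots,\mathfrak e_m$ and monomials $\mathfrak e_ib$ ($b\in\mathrm{Mon}(\mathcal P)$), with a total ordering of these monomials such that $b_1>b_2$ implies $\mathfrak e_ib_1>\mathfrak e_ib_2$, and $\mathfrak e_ib_1>\mathfrak e_jb_2$ implies $\mathfrak e_ib_1b>\mathfrak e_jb_2b$ whenever $b_1b\ne0\ne b_2b$. Let $ev:E\to M$ be given by $ev(\mathfrak e_ip)=\hat g_i\psi(p)$. A *signed element* of $M$ is a pair $g=(\mathrm{poly}(g),\sigma(g))$ with $\mathrm{poly}(g)\in M$ and $\sigma(g)$ a monomial of $E$ (its *signature*), such that there is $\tilde g\in E$ with $\mathrm{LM}(\tilde g)=\sigma(g)$ and $ev(\tilde g)=\mathrm{poly}(g)$. A *signed subset of $M\setminus\{0\}$* is a set of signed elements $g$ of $M$ with $\mathrm{poly}(g)\neq0$; write $\mathrm{LM}(g)=\mathrm{LM}(\mathrm{poly}(g))$. Let $G$ be such a set, $s$ a monomial of $E$, and $f\in F$. For $f\neq0$, $f$ is *$s$-reducible* (resp. *weakly $s$-reducible*) with respect to $G$ if there are $g\in G$ and a small cofactor $c$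 of $\mathrm{LM}(g)$ with $\mathrm{LM}(g)c=\mathrm{LM}(f)$, $\sigma(g)\lambda(c)\neq0$ and $\sigma(g)\lambda(c)<s$ (resp. $\le s$). $f$ is *$s$-irreducible* with respect to $G$ if $f=0$ or $f$ is not $s$-reducible with respect to $G$. For a signed element $f$, these notions are applied to $\mathrm{poly}(f)$ with $s=\sigma(f)$ unless said otherwise. "With respect to $M\setminus\{0\}$" means with respect to the set of all signed elements with non-zero $\mathrm{poly}$. $G$ is *interreduced* if every $g\in G$ is irreducible with respect to $G$ and there are no distinct $g,g'\in G$ and small cofactor $c$ of $\mathrm{LM}(g')$ with $\mathrm{LM}(g')c=\mathrm{LM}(g)$ and $\sigma(g')\lambda(c)=\sigma(g)$. A finite $G$ is a *signed standard basis* of $M$ if each signed element $f$ of $M\setminus\{0\}$ that is irreducible with respect to $M\setminus\{0\}$ is weakly $\sigma(f)$-reducible with respect to $G$. A *critical pair of type T* of $G$ with cofactor $c$ is a pair $(g,c)$ with $g\in G$ and $c$ the cofactor of a minimal toppling of $\mathrm{LM}(g)$. A *critical pair of type S* with cofactor $c$ is a pair $(g,g')$ of elements of $G$ such that $c$ is a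 small cofactor of $\mathrm{LM}(g)$, $\mathrm{LM}(g')=\mathrm{LM}(g)c$, and $0\neq\sigma(g)\lambda(c)>\sigma(g')$. In both cases, $\sigma(g)\lambda(c)$ is the signature of the pair. The pair is *normal* if $g$ (and, for type S, $g'$) is irreducible with respect to $G$, and $\sigma(g)\lambda(c)$ is non-zero and not the leading monomial of an element of $\ker(ev)$. $G$ satisfies the *$F_5$ criterion* if for each normal critical pair of type T or S, with signature $s$, there are $h\in G$ and a small cofactor $d$ of $\mathrm{LM}(h)$ such that $\sigma(h)\lambda(d)=s$ and $\mathrm{poly}(h)d$ is $s$-irreducible with respect to $G$. **Theorem.** Let $G$ be an interreduced finite signed subset of $M\setminus\{0\}$. Assume that for each $i=1,\dots,m$ and each vertex $v$ such that $\mathfrak e_i1_v$ is not the leading monomial of an element of $\ker(ev)$, there is some $g\in G$ with $\sigma(g)=\mathfrak e_i1_v$. Then $G$ is a signed standard basis of $M$ if and only if $G$ satisfies the $F_5$ criterion. -/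

import Mathlib

namespace SignedSB

noncomputable section

universe u v w x

/-! ### Path algebras -/

/-- The monomials of the path algebra of a quiver: the directed paths, including the trivial
path at every vertex. -/
@[ext]
structure PathMon (V : Type u) [Quiver.{v} V] where
  /-- start point -/
  src : V
  /-- end point -/
  tgt : V
  /-- the path -/
  path : Quiver.Path src tgt

namespace PathMon

variable {V : Type u} [Quiver.{v} V]

/-- The trivial path `1_a` at the vertex `a`. -/
def triv (a : V) : PathMon V := ⟨a, a, Quiver.Path.nil⟩

open Classical in
/-- Concatenation of paths (first `b`, then `c`); `none` stands for the product `0`. -/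
def mul (b c : PathMon V) : Option (PathMon V) :=
  if h : b.tgt = c.src then some ⟨b.src, c.tgt, b.path.comp (c.path.cast h.symm rfl)⟩ else none

theorem mul_mk {a b c : V} (p : Quiver.Path a b) (q : Quiver.Path b c) :
    mul ⟨a, b, p⟩ ⟨b, c, q⟩ = some ⟨a, c, p.comp q⟩ := by
  simp [mul]

theorem mul_eq_none {b c : PathMon V} (h : b.tgt ≠ c.src) : mul b c = none := by
  simp [mul, h]

theorem triv_mul (a : V) (b : PathMon V) (h : a = b.src) : mul (triv a) b = some b := by
  subst h
  obtain ⟨s, t, p⟩ := b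
  simp [triv, mul_mk]

theorem mul_triv (a : V) (b : PathMon V) (h : b.tgt = a) : mul b (triv a) = some b := by
  subst h
  obtain ⟨s, t, p⟩ := b
  simp [triv, mul_mk]

theorem mul_bind_assoc (a b c : PathMon V) :
    (mul a b).bind (fun d => mul d c) = (mul b c).bind (fun d => mul a d) := by
  obtain ⟨a₁, a₂, p⟩ := a
  obtain ⟨b₁, b₂, q⟩ := b
  obtain ⟨c₁, c₂, r⟩ := c
  by_cases h₁ : a₂ = b₁
  · subst h₁
    by_cases h₂ : b₂ = c₁
    · subst h₂
      simp [mul_mk, Quiver.Path.comp_assoc]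
    · simp [mul, h₂]
  · by_cases h₂ : b₂ = c₁
    · subst h₂
      simp [mul, h₁]
    · simp [mul, h₁, h₂]

end PathMon

/-- The path algebra over `K` of the quiver `V`: formal `K`-linear combinations of paths. -/
def PathAlgebra (K : Type w) [Field K] (V : Type u) [Quiver.{v} V] := PathMon V →₀ K

namespace PathAlgebra

variable {K : Type w} [Field K] {V : Type u} [Quiver.{v} V]

instance : AddCommGroup (PathAlgebra K V) := inferInstanceAs (AddCommGroup (PathMon V →₀ K))

instance : Module K (PathAlgebra K V) := inferInstanceAs (Module K (PathMon V →₀ K))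

/-- A path as an element of the path algebra. -/
def mono (b : PathMon V) : PathAlgebra K V := Finsupp.single b (1 : K)

/-- A path, or `0`, as an element of the path algebra. -/
def mono? : Option (PathMon V) → PathAlgebra K V
  | some b => mono b
  | none => 0

/-- The multiplication: the bilinear extension of the concatenation of paths. -/
def mulₗ : PathAlgebra K V →ₗ[K] PathAlgebra K V →ₗ[K] PathAlgebra K V :=
  Finsupp.linearCombination K fun a : PathMon V =>
    (Finsupp.linearCombination K fun b : PathMon V => (mono? (a.mul b) : PathAlgebra K V) :
      (PathMon V →₀ K) →ₗ[K] PathAlgebra K V)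

instance : Mul (PathAlgebra K V) := ⟨fun p q => mulₗ p q⟩

instance [Fintype V] : One (PathAlgebra K V) := ⟨∑ a : V, mono (PathMon.triv a)⟩

theorem mul_def (p q : PathAlgebra K V) : p * q = mulₗ p q := rfl

theorem one_def [Fintype V] : (1 : PathAlgebra K V) = ∑ a : V, mono (PathMon.triv a) := rfl

theorem mono_mul_mono (a b : PathMon V) :
    (mono a * mono b : PathAlgebra K V) = mono? (a.mul b) := by
  rw [mul_def]
  unfold mulₗ mono
  erw [Finsupp.linearCombination_single, one_smul, Finsupp.linearCombination_single, one_smul]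

theorem induction_mono {C : PathAlgebra K V → Prop} (p : PathAlgebra K V) (h0 : C 0)
    (hadd : ∀ p q, C p → C q → C (p + q)) (hmono : ∀ (k : K) b, C (k • mono b)) : C p := by
  refine Finsupp.induction_linear (motive := C) p h0 hadd fun b k => ?_
  have h : (Finsupp.single b k : PathMon V →₀ K) = k • Finsupp.single b (1 : K) := by simp
  rw [h]
  exact hmono k b

theorem pa_add_mul (p q r : PathAlgebra K V) : (p + q) * r = p * r + q * r := by
  simp only [mul_def, map_add, LinearMap.add_apply]

theorem pa_mul_add (p q r : PathAlgebra K V) : p * (q + r) = p * q + p * r := by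
  simp only [mul_def, map_add]

theorem pa_zero_mul (p : PathAlgebra K V) : 0 * p = 0 := by
  simp only [mul_def, map_zero, LinearMap.zero_apply]

theorem pa_mul_zero (p : PathAlgebra K V) : p * 0 = 0 := by
  simp only [mul_def, map_zero]

theorem pa_smul_mul (k : K) (p q : PathAlgebra K V) : (k • p) * q = k • (p * q) := by
  simp only [mul_def, map_smul, LinearMap.smul_apply]

theorem pa_mul_smul (k : K) (p q : PathAlgebra K V) : p * (k • q) = k • (p * q) := by
  simp only [mul_def, map_smul]

theorem mono_assoc (a b c : PathMon V) :
    (mono a * mono b * mono c : PathAlgebra K V) = mono a * (mono b * mono c) := by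
  have h := PathMon.mul_bind_assoc a b c
  have h1 : ∀ o : Option (PathMon V),
      (mono? o * mono c : PathAlgebra K V) = mono? (o.bind fun d => d.mul c) := by
    rintro (_ | d)
    · exact pa_zero_mul _
    · exact mono_mul_mono d c
  have h2 : ∀ o : Option (PathMon V),
      (mono a * mono? o : PathAlgebra K V) = mono? (o.bind fun d => a.mul d) := by
    rintro (_ | d)
    · exact pa_mul_zero _
    · exact mono_mul_mono a d
  rw [mono_mul_mono, mono_mul_mono, h1, h2, h]

theorem pa_mul_assoc (p q r : PathAlgebra K V) : p * q * r = p * (q * r) := by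
  induction p using induction_mono with
  | h0 => simp only [pa_zero_mul]
  | hadd p p' hp hp' => simp only [pa_add_mul, hp, hp']
  | hmono k a =>
    simp only [pa_smul_mul]
    congr 1
    induction q using induction_mono with
    | h0 => simp only [pa_zero_mul, pa_mul_zero]
    | hadd q q' hq hq' => simp only [pa_add_mul, pa_mul_add, hq, hq']
    | hmono l b =>
      simp only [pa_smul_mul, pa_mul_smul]
      congr 1
      induction r using induction_mono with
      | h0 => simp only [pa_mul_zero]
      | hadd r r' hr hr' => simp only [pa_mul_add, hr, hr']
      | hmono j c =>
        simp only [pa_mul_smul]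
        congr 1
        exact mono_assoc a b c

theorem pa_one_mul [Fintype V] (p : PathAlgebra K V) : 1 * p = p := by
  induction p using induction_mono with
  | h0 => exact pa_mul_zero _
  | hadd p q hp hq => rw [pa_mul_add, hp, hq]
  | hmono k b =>
    rw [pa_mul_smul, one_def, mul_def, map_sum, LinearMap.sum_apply,
      Finset.sum_eq_single b.src]
    · rw [← mul_def, mono_mul_mono, PathMon.triv_mul _ _ rfl]
      rfl
    · intro a _ ha
      rw [← mul_def, mono_mul_mono, PathMon.mul_eq_none (by simpa [PathMon.triv] using ha)]
      rfl
    · simp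

theorem pa_mul_one [Fintype V] (p : PathAlgebra K V) : p * 1 = p := by
  induction p using induction_mono with
  | h0 => exact pa_zero_mul _
  | hadd p q hp hq => rw [pa_add_mul, hp, hq]
  | hmono k b =>
    rw [pa_smul_mul, one_def, mul_def, map_sum, Finset.sum_eq_single b.tgt]
    · rw [← mul_def, mono_mul_mono, PathMon.mul_triv _ _ rfl]
      rfl
    · intro a _ ha
      rw [← mul_def, mono_mul_mono,
        PathMon.mul_eq_none (by simpa [PathMon.triv] using fun h => ha h.symm)]
      rfl
    · simp

instance [Fintype V] : Ring (PathAlgebra K V) :=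
  { (inferInstance : AddCommGroup (PathAlgebra K V)) with
    left_distrib := pa_mul_add
    right_distrib := pa_add_mul
    zero_mul := pa_zero_mul
    mul_zero := pa_mul_zero
    mul_assoc := pa_mul_assoc
    one_mul := pa_one_mul
    mul_one := pa_mul_one }

instance [Fintype V] : Algebra K (PathAlgebra K V) :=
  Algebra.ofModule pa_smul_mul pa_mul_smul

end PathAlgebra

open PathAlgebra

/-! ### Leading monomials -/

section Leading

/-- Let `mon : ι → X` be a family of vectors (the "monomials" of `X`) and `lt` an ordering of the
index set. `IsLM K lt mon f i` says: `f` is a linear combination of monomials in which `mon i`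
occurs with non-zero coefficient and all other occurring monomials are smaller. -/
def IsLM (K : Type w) [Field K] {ι : Type u} {X : Type v} [AddCommGroup X] [Module K X]
    (lt : ι → ι → Prop) (mon : ι → X) (f : X) (i : ι) : Prop :=
  ∃ p : ι →₀ K, Finsupp.linearCombination K mon p = f ∧
    p i ≠ 0 ∧ ∀ j, p j ≠ 0 → j ≠ i → lt j i

end Leading

/-! ### Monomial orderings on a path algebra and on its quotients -/

section Quotient

variable {V : Type u} [Quiver.{v} V]

/-- Monomial orderings of a path algebra (`lt b c` means `b < c`): total orderings of the paths,
compatible with non-zero products. -/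
structure IsMonomialOrder (lt : PathMon V → PathMon V → Prop) : Prop where
  total : IsStrictTotalOrder (PathMon V) lt
  mul_lt_mul : ∀ b₁ b₂ b b' c₁ c₂ d₁ d₂ : PathMon V, lt b₂ b₁ →
    b₁.mul b = some c₁ → b₂.mul b = some c₂ → b'.mul b₁ = some d₁ → b'.mul b₂ = some d₂ →
    lt c₂ c₁ ∧ lt d₂ d₁

variable [Fintype V] {K : Type w} [Field K] {A : Type x} [Ring A] [Algebra K A]
variable (ψ : PathAlgebra K V →ₐ[K] A) (lt : PathMon V → PathMon V → Prop)

/-- Standard monomials: paths that are not leading monomials of elements of the kernel of the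
quotient map `ψ`. -/
def IsStd (b : PathMon V) : Prop :=
  ∀ z : PathAlgebra K V, ψ z = 0 → ¬ IsLM K lt (mono : PathMon V → PathAlgebra K V) z b

/-- The index set of the monomials of `A`. A monomial `ψ (mono b)` of `A` is represented by its
lift, the standard path `b`. -/
abbrev StdMon := {b : PathMon V // IsStd ψ lt b}

variable {ψ lt}

/-- The monomial of `A` with a given lift. -/
def monA (b : StdMon ψ lt) : A := ψ (mono b.1)

/-- The ordering on the monomials of `A`. -/
def ltA (b c : StdMon ψ lt) : Prop := lt b.1 c.1

variable (ψ lt) in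
/-- The monomials of `A` span `A` (they are always linearly independent). -/
def PreferredBasisSpans : Prop :=
  Submodule.span K (Set.range (monA : StdMon ψ lt → A)) = ⊤

variable (ψ lt) in
/-- There is no infinite strictly decreasing sequence of monomials of `A`. -/
def IsAdmissible : Prop :=
  ¬ ∃ b : ℕ → StdMon ψ lt, ∀ n, ltA (b (n + 1)) (b n)

/-- `b` is the leading monomial of `a` in `A`. -/
def IsLMA (a : A) (b : StdMon ψ lt) : Prop := IsLM K ltA (monA : StdMon ψ lt → A) a b

/-- Strict divisibility of monomials of `A`: divisibility of the lifts as paths. -/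
def StrictDvd (b c : StdMon ψ lt) : Prop := ∃ d : PathMon V, b.1.mul d = some c.1

/-- `t` (a monomial of `A`, or `none` for zero) is a toppling of `b` with cofactor `c`: either
`LM (b * c) = t` and `t` does not come from the concatenation of the lifts of `b` and `c`,
or `b * c = 0 = t`. -/
def IsToppling (b : StdMon ψ lt) (t : Option (StdMon ψ lt)) (c : StdMon ψ lt) : Prop :=
  (∃ t', t = some t' ∧ IsLMA (monA b * monA c) t' ∧ b.1.mul c.1 ≠ some t'.1) ∨
    (t = none ∧ monA b * monA c = 0)

/-- `c` is a small cofactor of `b`: it is not the cofactor of a toppling of `b`. -/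
def IsSmall (b c : StdMon ψ lt) : Prop := ¬ ∃ t, IsToppling b t c

/-- `t` is a minimal toppling of `b` with cofactor `c`. -/
def IsMinimalToppling (b : StdMon ψ lt) (t : Option (StdMon ψ lt)) (c : StdMon ψ lt) : Prop :=
  IsToppling b t c ∧ ∀ c', StrictDvd c' c → c' ≠ c → IsSmall b c'

/-! ### The free right modules `F = A ^ r` and `E = P ^ m` -/

/-- The monomial `v_i * b` of the free module `F = A ^ r`. -/
def monF {r : ℕ} (b : Fin r × StdMon ψ lt) : Fin r → A := Pi.single b.1 (monA b.2)

/-- Monomial orderings on `F`, compatible with the ordering on `A`. For a small cofactor `b` of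
`b₁`, the product `b₁ * b` is the monomial `q` of `A` whose lift is the concatenation. -/
structure IsOrderF {r : ℕ} (ltF : Fin r × StdMon ψ lt → Fin r × StdMon ψ lt → Prop) : Prop where
  total : IsStrictTotalOrder (Fin r × StdMon ψ lt) ltF
  compat : ∀ (i : Fin r) (b₁ b₂ : StdMon ψ lt), ltA b₂ b₁ → ltF (i, b₂) (i, b₁)
  mul_lt_mul : ∀ (i j : Fin r) (b₁ b₂ b q t : StdMon ψ lt), IsSmall b₁ b →
    ltF (j, b₂) (i, b₁) → b₁.1.mul b.1 = some q.1 → IsLMA (monA b₂ * monA b) t →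
    ltF (j, t) (i, q)

variable (K) in
/-- The monomial `e_i * b` of the free module `E = P ^ m` over the path algebra `P`. -/
def monE {m : ℕ} (b : Fin m × PathMon V) : Fin m → PathAlgebra K V := Pi.single b.1 (mono b.2)

/-- Monomial orderings on `E`, compatible with the ordering on the path algebra. -/
structure IsOrderE (lt : PathMon V → PathMon V → Prop) {m : ℕ}
    (ltE : Fin m × PathMon V → Fin m × PathMon V → Prop) : Prop where
  total : IsStrictTotalOrder (Fin m × PathMon V) ltE
  compat : ∀ (i : Fin m) (b₁ b₂ : PathMon V), lt b₂ b₁ → ltE (i, b₂) (i, b₁)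
  mul_lt_mul : ∀ (i j : Fin m) (b₁ b₂ b c₁ c₂ : PathMon V), ltE (j, b₂) (i, b₁) →
    b₁.mul b = some c₁ → b₂.mul b = some c₂ → ltE (j, c₂) (i, c₁)

variable (ψ) in
/-- The evaluation map `E → F` that sends `e_i * p` to `ĝ_i * ψ p`. -/
def ev {r m : ℕ} (ghat : Fin m → Fin r → A) (p : Fin m → PathAlgebra K V) : Fin r → A :=
  ∑ i, MulOpposite.op (ψ (p i)) • ghat i

/-- The product of a monomial of `E` with a path; `none` stands for `0`. -/
def sigMul {m : ℕ} (s : Fin m × PathMon V) (c : PathMon V) : Option (Fin m × PathMon V) :=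
  (s.2.mul c).map fun d => (s.1, d)

end Quotient

/-! ### Signed elements, signed standard bases and the F5 criterion -/

section Signed

variable {V : Type u} [Quiver.{v} V] [Fintype V] {K : Type w} [Field K] {A : Type x} [Ring A]
  [Algebra K A] {ψ : PathAlgebra K V →ₐ[K] A} {lt : PathMon V → PathMon V → Prop} {r m : ℕ}

/-- A monomial of `E` is the leading monomial of an element of `ker ev`. -/
def IsKerLM (ψ : PathAlgebra K V →ₐ[K] A) (ltE : Fin m × PathMon V → Fin m × PathMon V → Prop)
    (ghat : Fin m → Fin r → A) (s : Fin m × PathMon V) : Prop :=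
  ∃ z : Fin m → PathAlgebra K V, ev ψ ghat z = 0 ∧ IsLM K ltE (monE K) z s

/-- `g = (f, s)` is a signed element of the submodule `M`, with unsigned element `f` and
signature `s`. -/
def IsSigned (ψ : PathAlgebra K V →ₐ[K] A) (ltE : Fin m × PathMon V → Fin m × PathMon V → Prop)
    (ghat : Fin m → Fin r → A) (M : Submodule Aᵐᵒᵖ (Fin r → A))
    (g : (Fin r → A) × (Fin m × PathMon V)) : Prop :=
  g.1 ∈ M ∧ ∃ p : Fin m → PathAlgebra K V, IsLM K ltE (monE K) p g.2 ∧ ev ψ ghat p = g.1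

/-- The signed elements of `M \ {0}`. -/
def signedNonzero (ψ : PathAlgebra K V →ₐ[K] A)
    (ltE : Fin m × PathMon V → Fin m × PathMon V → Prop)
    (ghat : Fin m → Fin r → A) (M : Submodule Aᵐᵒᵖ (Fin r → A)) :
    Set ((Fin r → A) × (Fin m × PathMon V)) :=
  {g | IsSigned ψ ltE ghat M g ∧ g.1 ≠ 0}

variable (ltF : Fin r × StdMon ψ lt → Fin r × StdMon ψ lt → Prop)

/-- `LM (f) = v_i * b` in `F`, where `n = (i, b)`. -/
def IsLMF (f : Fin r → A) (n : Fin r × StdMon ψ lt) : Prop := IsLM K ltF monF f n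

/-- `c` is a small cofactor of `LM (g)` and `LM (g) * c = n`. -/
def SmallMulEq (g : Fin r → A) (c : StdMon ψ lt) (n : Fin r × StdMon ψ lt) : Prop :=
  ∃ b : StdMon ψ lt, IsLMF ltF g (n.1, b) ∧ IsSmall b c ∧ b.1.mul c.1 = some n.2.1

variable (ltE : Fin m × PathMon V → Fin m × PathMon V → Prop)

/-- `f` is `s`-reducible with respect to `G`: there are `g ∈ G` and a small cofactor `c` of
`LM (g)` with `LM (g) * c = LM (f)` and `σ(g) * λ(c) < s`, where `σ(g) * λ(c)` is required to be
a monomial, that is, non-zero. -/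
def SReducible (G : Set ((Fin r → A) × (Fin m × PathMon V))) (s : Fin m × PathMon V)
    (f : Fin r → A) : Prop :=
  ∃ g ∈ G, ∃ (c : StdMon ψ lt) (n : Fin r × StdMon ψ lt) (s' : Fin m × PathMon V),
    IsLMF ltF f n ∧ SmallMulEq ltF g.1 c n ∧ sigMul g.2 c.1 = some s' ∧ ltE s' s

/-- `f` is weakly `s`-reducible with respect to `G`. -/
def WeaklySReducible (G : Set ((Fin r → A) × (Fin m × PathMon V))) (s : Fin m × PathMon V)
    (f : Fin r → A) : Prop :=
  ∃ g ∈ G, ∃ (c : StdMon ψ lt) (n : Fin r × StdMon ψ lt) (s' : Fin m × PathMon V),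
    IsLMF ltF f n ∧ SmallMulEq ltF g.1 c n ∧ sigMul g.2 c.1 = some s' ∧ (ltE s' s ∨ s' = s)

/-- `f` is `s`-irreducible with respect to `G`. -/
def SIrreducible (G : Set ((Fin r → A) × (Fin m × PathMon V))) (s : Fin m × PathMon V)
    (f : Fin r → A) : Prop :=
  f = 0 ∨ ¬ SReducible ltF ltE G s f

/-- Interreduced signed sets. -/
def IsInterreduced (G : Set ((Fin r → A) × (Fin m × PathMon V))) : Prop :=
  (∀ g ∈ G, SIrreducible ltF ltE G g.2 g.1) ∧
    ∀ g ∈ G, ¬ ∃ g' ∈ G, g' ≠ g ∧ ∃ (c : StdMon ψ lt) (n : Fin r × StdMon ψ lt),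
      IsLMF ltF g.1 n ∧ SmallMulEq ltF g'.1 c n ∧ sigMul g'.2 c.1 = some g.2

/-- `G` is a signed standard basis of `M`. -/
def IsSignedStandardBasis (ghat : Fin m → Fin r → A) (M : Submodule Aᵐᵒᵖ (Fin r → A))
    (G : Set ((Fin r → A) × (Fin m × PathMon V))) : Prop :=
  ∀ f ∈ signedNonzero ψ ltE ghat M,
    SIrreducible ltF ltE (signedNonzero ψ ltE ghat M) f.2 f.1 →
      WeaklySReducible ltF ltE G f.2 f.1

/-- `(g, c)` is a critical pair of `G` of type T with cofactor `c`. -/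
def IsCriticalT (G : Set ((Fin r → A) × (Fin m × PathMon V)))
    (g : (Fin r → A) × (Fin m × PathMon V)) (c : StdMon ψ lt) : Prop :=
  g ∈ G ∧ ∃ n : Fin r × StdMon ψ lt, IsLMF ltF g.1 n ∧ ∃ t, IsMinimalToppling n.2 t c

/-- `(g, g')` is a critical pair of `G` of type S with cofactor `c`. -/
def IsCriticalS (G : Set ((Fin r → A) × (Fin m × PathMon V)))
    (g g' : (Fin r → A) × (Fin m × PathMon V)) (c : StdMon ψ lt) : Prop :=
  g ∈ G ∧ g' ∈ G ∧ (∃ n : Fin r × StdMon ψ lt, IsLMF ltF g'.1 n ∧ SmallMulEq ltF g.1 c n) ∧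
    ∃ s, sigMul g.2 c.1 = some s ∧ ltE g'.2 s

/-- `(g, c)` is a normal critical pair of type T, and `s = σ(g) * λ(c)` is the signature of its
S-polynomial. -/
def IsNormalT (ghat : Fin m → Fin r → A) (G : Set ((Fin r → A) × (Fin m × PathMon V)))
    (g : (Fin r → A) × (Fin m × PathMon V)) (c : StdMon ψ lt) (s : Fin m × PathMon V) : Prop :=
  IsCriticalT ltF G g c ∧ SIrreducible ltF ltE G g.2 g.1 ∧
    sigMul g.2 c.1 = some s ∧ ¬ IsKerLM ψ ltE ghat s

/-- `(g, g')` is a normal critical pair of type S with cofactor `c`, and `s = σ(g) * λ(c)` is the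
signature of its S-polynomial. -/
def IsNormalS (ghat : Fin m → Fin r → A) (G : Set ((Fin r → A) × (Fin m × PathMon V)))
    (g g' : (Fin r → A) × (Fin m × PathMon V)) (c : StdMon ψ lt) (s : Fin m × PathMon V) : Prop :=
  IsCriticalS ltF ltE G g g' c ∧
    SIrreducible ltF ltE G g.2 g.1 ∧ SIrreducible ltF ltE G g'.2 g'.1 ∧
    sigMul g.2 c.1 = some s ∧ ¬ IsKerLM ψ ltE ghat s

/-- There are `g ∈ G` and a small cofactor `c` of `LM (g)` with `σ(g) * λ(c) = s` such that
`poly(g) * c` is `s`-irreducible with respect to `G`. -/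
def IsCovered (G : Set ((Fin r → A) × (Fin m × PathMon V))) (s : Fin m × PathMon V) : Prop :=
  ∃ g ∈ G, ∃ (c : StdMon ψ lt) (n : Fin r × StdMon ψ lt), IsLMF ltF g.1 n ∧ IsSmall n.2 c ∧
    sigMul g.2 c.1 = some s ∧ SIrreducible ltF ltE G s (MulOpposite.op (monA c) • g.1)

/-- The F5 criterion: every normal critical pair, of type T or of type S, is covered. -/
def SatisfiesF5 (ghat : Fin m → Fin r → A)
    (G : Set ((Fin r → A) × (Fin m × PathMon V))) : Prop :=
  (∀ g c s, IsNormalT ltF ltE ghat G g c s → IsCovered ltF ltE G s) ∧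
    ∀ g g' c s, IsNormalS ltF ltE ghat G g g' c s → IsCovered ltF ltE G s

end Signed

end

end SignedSB

open SignedSB

/-! Call a monomial `s` of `E` covered when some `g ∈ G` and small cofactor `c` satisfy `σ(g)λ(c) =
s` with `poly(g)c` being `s`-irreducible with respect to `G` (`IsCovered`). Both sides of the
equivalence amount to one statement: every `s` that leads no element of `ker ev` is covered.

Standard basis ⇒ covered (`IsSignedStandardBasis.isCovered`): among the elements of `E` with leading
monomial `s`, reduction lowers the leading monomial of the evaluation and never reaches `0`, so an
irreducible one exists. `G` weakly reduces it; a strictly smaller signature is excluded, so equality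
holds, and this is a cover.

F5 ⇒ covered (`SatisfiesF5.isCovered`): induction on the path in `s`, one arrow at a time. Let `g,
c` cover `s₀` and let `s = s₀e`. If `ce` is not a small cofactor, it gives a minimal toppling, hence
a pair of type T. If it is small but `poly(g)ce` is reducible by `g'c'`, then either `c'` is
trivial, which gives a pair of type S, or `c'` also ends in `e`, and cancelling `e` makes `poly(g)c`
reducible, a contradiction.

Covered ⇒ standard basis (`isSignedStandardBasis_of_isCovered`): induction on the signature. An
irreducible `f` is compared with the cover `poly(h)e` of its signature by cancelling the leading
terms in `E`; unless the leading monomials in `F` agree, `f` or `poly(h)e` becomes reducible.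

Only standard paths are assumed to be well-ordered. The inductions on signatures work because
signatures outside the leading monomials of `ker ev` involve standard paths, and because evaluations
can be rewritten through normal forms. -/

namespace SignedSB

open PathAlgebra

universe u v w x

/-! ### Arithmetic of leading monomials for an arbitrary ordered family of vectors -/

section LeadingMonomials

variable {K : Type*} [Field K] {ι κ X Y : Type*} [AddCommGroup X] [Module K X]
  [AddCommGroup Y] [Module K Y] {lt : ι → ι → Prop} {mon : ι → X}
  {lt' : κ → κ → Prop} {mon' : κ → Y} {f g : X} {i j : ι}

/-- The span of the monomials that are smaller than the `i`-th one. -/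
def below (K : Type*) [Field K] {ι X : Type*} [AddCommGroup X] [Module K X]
    (lt : ι → ι → Prop) (mon : ι → X) (i : ι) : Submodule K X :=
  Submodule.span K (mon '' {j | lt j i})

theorem mon_mem_below (h : lt j i) : mon j ∈ below K lt mon i :=
  Submodule.subset_span ⟨j, h, rfl⟩

theorem below_mono [IsStrictTotalOrder ι lt] (h : lt j i) :
    below K lt mon j ≤ below K lt mon i :=
  Submodule.span_mono (Set.image_mono fun _ hk => _root_.trans hk h)

/-- This form turns arithmetic with leading terms into membership in the submodule `below`. It needs
no linear independence of the monomials. -/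
theorem isLM_iff [IsStrictTotalOrder ι lt] :
    IsLM K lt mon f i ↔ ∃ k : K, k ≠ 0 ∧ f - k • mon i ∈ below K lt mon i := by
  classical
  constructor
  · rintro ⟨p, rfl, hpi, hp⟩
    refine ⟨p i, hpi, (Finsupp.mem_span_image_iff_linearCombination K).2 ⟨p.erase i, ?_, ?_⟩⟩
    · intro j hj
      have hj : p.erase i j ≠ 0 := Finsupp.mem_support_iff.1 hj
      rcases eq_or_ne j i with rfl | hji
      · simp at hj
      · exact hp j (by rwa [Finsupp.erase_ne hji] at hj) hji
    · rw [eq_sub_iff_add_eq, ← Finsupp.linearCombination_single K (p i) i, ← map_add,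
        Finsupp.erase_add_single]
  · rintro ⟨k, hk, h⟩
    obtain ⟨q, hq, hqf⟩ := (Finsupp.mem_span_image_iff_linearCombination K).1 h
    have hq' : ∀ j, q j ≠ 0 → lt j i := fun j hj => hq (Finsupp.mem_support_iff.2 hj)
    have hqi : q i = 0 := by
      by_contra h
      exact irrefl_of lt i (hq' i h)
    refine ⟨q + Finsupp.single i k, ?_, ?_, ?_⟩
    · rw [map_add, hqf, Finsupp.linearCombination_single]
      abel
    · simpa [hqi] using hk
    · intro j hj hji
      exact hq' j (by simpa [Finsupp.single_apply, Ne.symm hji] using hj)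

theorem isLM_mon [IsStrictTotalOrder ι lt] (i : ι) : IsLM K lt mon (mon i) i :=
  isLM_iff.2 ⟨1, one_ne_zero, by simp⟩

theorem IsLM.smul [IsStrictTotalOrder ι lt] {k : K} (hk : k ≠ 0) (h : IsLM K lt mon f i) :
    IsLM K lt mon (k • f) i := by
  obtain ⟨l, hl, h⟩ := isLM_iff.1 h
  refine isLM_iff.2 ⟨k * l, mul_ne_zero hk hl, ?_⟩
  rw [mul_smul, ← smul_sub]
  exact Submodule.smul_mem _ _ h

theorem IsLM.add_mem_below [IsStrictTotalOrder ι lt] (h : IsLM K lt mon f i)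
    (hg : g ∈ below K lt mon i) : IsLM K lt mon (f + g) i := by
  obtain ⟨l, hl, h⟩ := isLM_iff.1 h
  refine isLM_iff.2 ⟨l, hl, ?_⟩
  rw [add_sub_right_comm]
  exact add_mem h hg

theorem IsLM.sub_mem_below [IsStrictTotalOrder ι lt] (h : IsLM K lt mon f i)
    (hg : g ∈ below K lt mon i) : IsLM K lt mon (f - g) i := by
  rw [sub_eq_add_neg]
  exact h.add_mem_below (neg_mem hg)

theorem IsLM.mem_below [IsStrictTotalOrder ι lt] (h : IsLM K lt mon f i) (hij : lt i j) :
    f ∈ below K lt mon j := by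
  obtain ⟨l, hl, h⟩ := isLM_iff.1 h
  rw [← sub_add_cancel f (l • mon i)]
  exact add_mem (below_mono hij h) (Submodule.smul_mem _ _ (mon_mem_below hij))

/-- Two vectors with the same leading monomial have the same leading term up to a scalar. -/
theorem IsLM.exists_sub_smul_mem_below [IsStrictTotalOrder ι lt] (hf : IsLM K lt mon f i)
    (hg : IsLM K lt mon g i) : ∃ k : K, k ≠ 0 ∧ f - k • g ∈ below K lt mon i := by
  obtain ⟨l, hl, hf⟩ := isLM_iff.1 hf
  obtain ⟨l', hl', hg⟩ := isLM_iff.1 hg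
  refine ⟨l * l'⁻¹, mul_ne_zero hl (inv_ne_zero hl'), ?_⟩
  have : f - (l * l'⁻¹) • g = (f - l • mon i) - (l * l'⁻¹) • (g - l' • mon i) := by
    rw [smul_sub, smul_smul, mul_assoc, inv_mul_cancel₀ hl', mul_one]
    abel
  rw [this]
  exact sub_mem hf (Submodule.smul_mem _ _ hg)

theorem exists_max_support [IsStrictTotalOrder ι lt] {p : ι →₀ K} (hp : p ≠ 0) :
    ∃ i, p i ≠ 0 ∧ ∀ j, p j ≠ 0 → j ≠ i → lt j i := by
  classical
  have hne : p.support.Nonempty := Finsupp.support_nonempty_iff.2 hp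
  let := linearOrderOfSTO lt
  exact ⟨p.support.max' hne, Finsupp.mem_support_iff.1 (Finset.max'_mem _ _), fun j hj hji =>
    lt_of_le_of_ne (Finset.le_max' _ _ (Finsupp.mem_support_iff.2 hj)) hji⟩

theorem exists_isLM_of_mem_span [IsStrictTotalOrder ι lt] {S : Set ι}
    (hf : f ∈ Submodule.span K (mon '' S)) (h0 : f ≠ 0) : ∃ i ∈ S, IsLM K lt mon f i := by
  obtain ⟨q, hq, rfl⟩ := (Finsupp.mem_span_image_iff_linearCombination K).1 hf
  obtain ⟨i, hi, hmax⟩ := exists_max_support (lt := lt) (p := q) (by rintro rfl; simp at h0)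
  exact ⟨i, hq (Finsupp.mem_support_iff.2 hi), q, rfl, hi, hmax⟩

theorem exists_isLM_of_span_eq_top [IsStrictTotalOrder ι lt]
    (hmon : Submodule.span K (Set.range mon) = ⊤) (h0 : f ≠ 0) : ∃ i, IsLM K lt mon f i := by
  obtain ⟨i, -, hi⟩ := exists_isLM_of_mem_span (lt := lt) (mon := mon) (S := Set.univ)
    (f := f) (K := K) (by simp [hmon]) h0
  exact ⟨i, hi⟩

theorem exists_isLM_of_mem_below [IsStrictTotalOrder ι lt] (hf : f ∈ below K lt mon i)
    (h0 : f ≠ 0) : ∃ j, lt j i ∧ IsLM K lt mon f j :=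
  exists_isLM_of_mem_span hf h0

theorem IsLM.ne_zero (hmon : LinearIndependent K mon) (h : IsLM K lt mon f i) : f ≠ 0 := by
  rintro rfl
  obtain ⟨p, hp, hpi, -⟩ := h
  have : p = 0 := linearIndependent_iff.1 hmon p hp
  simp [this] at hpi

theorem IsLM.unique [IsStrictTotalOrder ι lt] (hmon : LinearIndependent K mon)
    (hi : IsLM K lt mon f i) (hj : IsLM K lt mon f j) : i = j := by
  obtain ⟨p, rfl, hpi, hp⟩ := hi
  obtain ⟨q, hq, hqj, hq'⟩ := hj
  obtain rfl : q = p := hmon hq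
  by_contra hij
  exact asymm_of lt (hq' i hpi hij) (hp j hqj (Ne.symm hij))

/-- A family of vectors is linearly independent if no leading monomial belongs to zero. -/
theorem linearIndependent_of_not_isLM_zero [IsStrictTotalOrder ι lt]
    (h : ∀ i, ¬ IsLM K lt mon 0 i) : LinearIndependent K mon := by
  rw [linearIndependent_iff]
  intro p hp
  by_contra hp0
  obtain ⟨i, hi, hmax⟩ := exists_max_support (lt := lt) hp0
  exact h i ⟨p, hp, hi, hmax⟩

theorem map_mem_below (T : X →ₗ[K] Y) {i' : κ} (hf : f ∈ below K lt mon i)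
    (hlow : ∀ j, lt j i → T (mon j) ∈ below K lt' mon' i') : T f ∈ below K lt' mon' i' := by
  have : below K lt mon i ≤ (below K lt' mon' i').comap T :=
    Submodule.span_le.2 (by rintro _ ⟨j, hj, rfl⟩; exact hlow j hj)
  exact this hf

/-- The lower terms of `f` land in `below`, so the image of the leading term is undisturbed. Here
`T` may send lower monomials to `0`, as multiplication by a path does. -/
theorem IsLM.map [IsStrictTotalOrder ι lt] [IsStrictTotalOrder κ lt'] (T : X →ₗ[K] Y) {i' : κ}
    (h : IsLM K lt mon f i) (hi : IsLM K lt' mon' (T (mon i)) i')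
    (hlow : ∀ j, lt j i → T (mon j) ∈ below K lt' mon' i') : IsLM K lt' mon' (T f) i' := by
  obtain ⟨k, hk, h⟩ := isLM_iff.1 h
  rw [← sub_add_cancel f (k • mon i), add_comm, map_add, map_smul]
  exact (hi.smul hk).add_mem_below (map_mem_below T h hlow)

/-- A strict ordering of `Fin k × ι` is well-founded if its fibres are. -/
theorem wellFounded_fin_prod {k : ℕ} {R : Fin k × ι → Fin k × ι → Prop}
    [IsStrictTotalOrder (Fin k × ι) R]
    (h : ∀ i : Fin k, WellFounded fun b c : ι => R (i, b) (i, c)) : WellFounded R := by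
  -- Finitely many fibres cover the product, and a finite union of sets well-founded for a strict
  -- order is again well-founded.
  rw [← Set.wellFoundedOn_univ]
  have hU : (Set.univ : Set (Fin k × ι)) =
      ⋃ i ∈ (Finset.univ : Finset (Fin k)), Set.range (Prod.mk i) := by
    ext ⟨i, b⟩
    simp
  rw [hU, Finset.wellFoundedOn_bUnion]
  intro i _
  rw [Set.wellFoundedOn_range]
  exact h i

end LeadingMonomials

/-! ### Factorizations of paths -/

namespace PathMon

variable {V : Type u} [Quiver.{v} V]

theorem mul_eq_some {b c d : PathMon V} : b.mul c = some d ↔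
    ∃ (x y z : V) (p : Quiver.Path x y) (q : Quiver.Path y z),
      b = ⟨x, y, p⟩ ∧ c = ⟨y, z, q⟩ ∧ d = ⟨x, z, p.comp q⟩ := by
  constructor
  · obtain ⟨x, y, p⟩ := b
    obtain ⟨y', z, q⟩ := c
    intro h
    by_cases hy : y = y'
    · subst hy
      rw [mul_mk] at h
      exact ⟨x, y, z, p, q, rfl, rfl, (Option.some.inj h).symm⟩
    · rw [mul_eq_none (by exact hy)] at h
      cases h
  · rintro ⟨x, y, z, p, q, rfl, rfl, rfl⟩
    exact mul_mk p q

theorem tgt_of_mul {b c d : PathMon V} (h : b.mul c = some d) : b.tgt = c.src := by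
  obtain ⟨x, y, z, p, q, rfl, rfl, rfl⟩ := mul_eq_some.1 h
  rfl

theorem src_mul {b c d : PathMon V} (h : b.mul c = some d) : d.src = b.src := by
  obtain ⟨x, y, z, p, q, rfl, rfl, rfl⟩ := mul_eq_some.1 h
  rfl

theorem mul_mul_of_left {a b c ab abc : PathMon V} (h : a.mul b = some ab)
    (h' : ab.mul c = some abc) : ∃ bc, b.mul c = some bc ∧ a.mul bc = some abc := by
  have := mul_bind_assoc a b c
  rw [h, Option.bind_some, h', eq_comm, Option.bind_eq_some_iff] at this
  exact this

theorem mul_mul_of_right {a b c bc abc : PathMon V} (h : b.mul c = some bc)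
    (h' : a.mul bc = some abc) : ∃ ab, a.mul b = some ab ∧ ab.mul c = some abc := by
  have := mul_bind_assoc a b c
  rw [h, Option.bind_some, h', Option.bind_eq_some_iff] at this
  exact this

/-- Lengths add under concatenation. Hence a toppling whose cofactor is a trivial path is
automatically minimal. -/
theorem eq_triv_of_mul {a b : PathMon V} {y : V} (h : a.mul b = some (triv y)) :
    a = triv y ∧ b = triv y := by
  obtain ⟨x, z, w, p, q, rfl, rfl, hpq⟩ := mul_eq_some.1 h
  simp only [triv, mk.injEq] at hpq
  obtain ⟨rfl, rfl, hpq⟩ := hpq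
  have hl := congrArg Quiver.Path.length (eq_of_heq hpq)
  rw [Quiver.Path.length_comp, Quiver.Path.length_nil] at hl
  obtain rfl := p.eq_of_length_zero (by omega)
  rw [p.eq_nil_of_length_zero (by omega), q.eq_nil_of_length_zero (by omega)]
  exact ⟨rfl, rfl⟩

theorem mul_triv_eq {a b : PathMon V} {y : V} (h : a.mul (triv y) = some b) : a = b :=
  Option.some.inj ((mul_triv y a (tgt_of_mul h)).symm.trans h)

/-- An arrow as a path. -/
def arrow {y z : V} (e : y ⟶ z) : PathMon V := ⟨y, z, e.toPath⟩

theorem mk_mul_arrow {x y z : V} (p : Quiver.Path x y) (e : y ⟶ z) :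
    mul ⟨x, y, p⟩ (arrow e) = some ⟨x, z, p.cons e⟩ :=
  mul_mk p e.toPath

theorem eq_triv_or_mul_arrow (b : PathMon V) :
    (∃ y, b = triv y) ∨ ∃ (c : PathMon V) (y z : V) (e : y ⟶ z), c.mul (arrow e) = some b := by
  obtain ⟨x, y, p⟩ := b
  cases p with
  | nil => exact Or.inl ⟨x, rfl⟩
  | cons p e => exact Or.inr ⟨_, _, _, e, mk_mul_arrow p e⟩

theorem mul_arrow_inj {a b c : PathMon V} {y z y' z' : V} {e : y ⟶ z} {e' : y' ⟶ z'}
    (h : a.mul (arrow e) = some c) (h' : b.mul (arrow e') = some c) :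
    a = b ∧ (arrow e : PathMon V) = arrow e' := by
  obtain ⟨x, s, p⟩ := a
  obtain ⟨x', s', p'⟩ := b
  obtain rfl : s = y := tgt_of_mul h
  obtain rfl : s' = y' := tgt_of_mul h'
  rw [mk_mul_arrow] at h h'
  have := Option.some.inj (h.trans h'.symm)
  simp only [mk.injEq] at this
  obtain ⟨rfl, rfl, h⟩ := this
  have h := eq_of_heq h
  obtain rfl := Quiver.Path.obj_eq_of_cons_eq_cons h
  obtain rfl := eq_of_heq (Quiver.Path.heq_of_cons_eq_cons h)
  obtain rfl := eq_of_heq (Quiver.Path.hom_heq_of_cons_eq_cons h)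
  exact ⟨rfl, rfl⟩

/-- A proper initial segment of `b * e`, for an arrow `e`, is an initial segment of `b`. -/
theorem exists_mul_of_mul_arrow {b c d t : PathMon V} {y z : V} {e : y ⟶ z}
    (h : b.mul (arrow e) = some c) (h' : d.mul t = some c) (hd : d ≠ c) :
    ∃ t', d.mul t' = some b := by
  rcases eq_triv_or_mul_arrow t with ⟨w, rfl⟩ | ⟨t', y', z', e', ht⟩
  · exact absurd (mul_triv_eq h') hd
  · obtain ⟨d', hd', hd''⟩ := mul_mul_of_right ht h'
    obtain ⟨rfl, -⟩ := mul_arrow_inj h hd''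
    exact ⟨t', hd'⟩

end PathMon

/-! ### Standard monomials, small cofactors and normal forms -/

section StandardMonomials

variable {V : Type u} [Quiver.{v} V] [Fintype V] {K : Type w} [Field K] {A : Type x} [Ring A]
  [Algebra K A] {ψ : PathAlgebra K V →ₐ[K] A} {lt : PathMon V → PathMon V → Prop} {r m : ℕ}

instance [IsStrictTotalOrder (PathMon V) lt] :
    IsStrictTotalOrder (StdMon ψ lt) (ltA : StdMon ψ lt → StdMon ψ lt → Prop) where
  trichotomous _ _ h h' := Subtype.ext (Std.Trichotomous.trichotomous (r := lt) _ _ h h')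
  irrefl a := irrefl_of lt a.1
  trans _ _ _ h h' := trans_of lt h h'

omit [Fintype V] in
theorem IsMonomialOrder.mul_mul_lt (hlt : IsMonomialOrder lt) {a b x y c d s t : PathMon V}
    (h : lt b a) (hx : s.mul a = some x) (hc : x.mul t = some c) (hy : s.mul b = some y)
    (hd : y.mul t = some d) : lt d c := by
  obtain ⟨a', ha', -⟩ := PathMon.mul_mul_of_left hx hc
  obtain ⟨b', hb', -⟩ := PathMon.mul_mul_of_left hy hd
  have h1 : lt y x := (hlt.mul_lt_mul a b t s _ _ _ _ h ha' hb' hx hy).2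
  -- The ordering axiom asks for left and right products together; the trivial path at the common
  -- source is a neutral left factor.
  exact (hlt.mul_lt_mul x y t (PathMon.triv s.src) _ _ _ _ h1 hc hd
    (PathMon.triv_mul _ _ (PathMon.src_mul hx).symm)
    (PathMon.triv_mul _ _ (PathMon.src_mul hy).symm)).1

/-- Factors of standard monomials are standard. -/
theorem IsStd.of_mul_mul (hlt : IsMonomialOrder lt) {a x c s t : PathMon V}
    (hx : s.mul a = some x) (hc : x.mul t = some c) (h : IsStd ψ lt c) : IsStd ψ lt a := by
  have := hlt.total
  intro z hz hLM
  -- Sandwiching an element of the kernel between `s` and `t` stays in the kernel, and lower paths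
  -- stay lower or vanish, so `c` would lead a kernel element.
  refine h (mono s * z * mono t) (by simp [hz]) (hLM.map
    ((LinearMap.mulRight K (mono t)) ∘ₗ (LinearMap.mulLeft K (mono s))) ?_ fun j hj => ?_)
  · have : (mono s * mono a * mono t : PathAlgebra K V) = mono c := by
      rw [mono_mul_mono, hx, mono?, mono_mul_mono, hc, mono?]
    simp only [LinearMap.comp_apply, LinearMap.mulRight_apply, LinearMap.mulLeft_apply, this]
    exact isLM_mon c
  · simp only [LinearMap.comp_apply, LinearMap.mulRight_apply, LinearMap.mulLeft_apply]
    rw [mono_mul_mono]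
    rcases hy : s.mul j with _ | y
    · simp [mono?]
    · rw [mono?, mono_mul_mono]
      rcases hd : y.mul t with _ | d
      · simp [mono?]
      · exact mon_mem_below (hlt.mul_mul_lt hj hx hc hy hd)

theorem IsStd.of_mul_left (hlt : IsMonomialOrder lt) {a b c : PathMon V}
    (hc : a.mul b = some c) (h : IsStd ψ lt c) : IsStd ψ lt a :=
  h.of_mul_mul hlt (PathMon.triv_mul _ _ rfl) hc

theorem IsStd.of_mul_right (hlt : IsMonomialOrder lt) {a b c : PathMon V}
    (hc : a.mul b = some c) (h : IsStd ψ lt c) : IsStd ψ lt b :=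
  h.of_mul_mul hlt hc (PathMon.mul_triv _ _ rfl)

/-- A linear relation among the monomials of `A` lifts to an element of `ker ψ` whose leading
monomial is a standard path, which is impossible. -/
theorem linearIndependent_monA (hlt : IsMonomialOrder lt) :
    LinearIndependent K (monA : StdMon ψ lt → A) := by
  have := hlt.total
  refine linearIndependent_of_not_isLM_zero (lt := ltA) fun b hb => ?_
  obtain ⟨p, hp, hpb, hmax⟩ := hb
  have hinj : Function.Injective (Subtype.val : StdMon ψ lt → PathMon V) :=
    Subtype.val_injective
  refine b.2 (Finsupp.linearCombination K (fun c : StdMon ψ lt => mono c.1) p) ?_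
    ⟨p.mapDomain Subtype.val, ?_, ?_, fun j hj hjb => ?_⟩
  · rw [← hp]
    exact Finsupp.apply_linearCombination K ψ.toLinearMap _ p
  · rw [Finsupp.linearCombination_mapDomain]
    rfl
  · rwa [Finsupp.mapDomain_apply hinj]
  · by_cases hjr : j ∈ Set.range (Subtype.val : StdMon ψ lt → PathMon V)
    · obtain ⟨j, rfl⟩ := hjr
      rw [Finsupp.mapDomain_apply hinj] at hj
      exact hmax j hj fun h => hjb (congrArg _ h)
    · exact absurd (Finsupp.mapDomain_of_notMem_range _ _ hjr) hj

theorem linearIndependent_monF (hlt : IsMonomialOrder lt) :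
    LinearIndependent K (monF : Fin r × StdMon ψ lt → Fin r → A) := by
  have h := Pi.linearIndependent_single (η := Fin r) (ιs := fun _ => StdMon ψ lt)
    (Ms := fun _ => A) (R := K) (fun _ => monA) fun _ => linearIndependent_monA hlt
  exact h.comp (Equiv.sigmaEquivProd (Fin r) (StdMon ψ lt)).symm (Equiv.injective _)

theorem span_monF (hspan : PreferredBasisSpans ψ lt) :
    Submodule.span K (Set.range (monF : Fin r × StdMon ψ lt → Fin r → A)) = ⊤ := by
  rw [eq_top_iff]
  intro f _
  rw [← Finset.univ_sum_single f]
  refine sum_mem fun i _ => ?_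
  have h : Submodule.span K (Set.range (monA : StdMon ψ lt → A)) ≤
      (Submodule.span K (Set.range (monF : Fin r × StdMon ψ lt → Fin r → A))).comap
        (LinearMap.single K (fun _ : Fin r => A) i) := by
    rw [Submodule.span_le]
    rintro _ ⟨b, rfl⟩
    exact Submodule.subset_span ⟨(i, b), rfl⟩
  rw [hspan] at h
  exact h (Submodule.mem_top (x := f i))

theorem monA_mul_monA {b c q : StdMon ψ lt} (h : b.1.mul c.1 = some q.1) :
    monA b * monA c = monA q := by
  rw [monA, monA, ← map_mul, mono_mul_mono, h]
  rfl

theorem IsLMA.unique (hlt : IsMonomialOrder lt) {a : A} {b c : StdMon ψ lt} (hb : IsLMA a b)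
    (hc : IsLMA a c) : b = c := by
  have := hlt.total
  unfold IsLMA at hb hc
  exact IsLM.unique (lt := (ltA : StdMon ψ lt → StdMon ψ lt → Prop))
    (linearIndependent_monA (ψ := ψ) hlt) hb hc

/-- The small cofactors of `b` are those that can be concatenated with `b` to a standard
monomial. -/
theorem isSmall_iff (hlt : IsMonomialOrder lt) (hspan : PreferredBasisSpans ψ lt)
    {b c : StdMon ψ lt} : IsSmall b c ↔ ∃ q : StdMon ψ lt, b.1.mul c.1 = some q.1 := by
  have := hlt.total
  constructor
  · intro h
    by_contra hq
    push Not at hq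
    by_cases h0 : monA b * monA c = 0
    · exact h ⟨none, Or.inr ⟨rfl, h0⟩⟩
    · obtain ⟨t, ht⟩ := exists_isLM_of_span_eq_top (K := K) (lt := ltA) (mon := (monA : StdMon ψ lt → A))
        hspan h0
      exact h ⟨some t, Or.inl ⟨t, rfl, ht, hq t⟩⟩
  · rintro ⟨q, hq⟩ ⟨t, ht⟩
    rw [IsToppling, monA_mul_monA hq] at ht
    rcases ht with ⟨t', -, ht', hne⟩ | ⟨-, h0⟩
    · have hq' : IsLMA (monA q) q := isLM_mon (mon := monA) q
      rw [ht'.unique hlt hq'] at hne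
      exact hne hq
    · exact (linearIndependent_monA hlt).ne_zero q h0

theorem wellFounded_ltA (hadm : IsAdmissible ψ lt) :
    WellFounded (ltA : StdMon ψ lt → StdMon ψ lt → Prop) :=
  wellFounded_iff_isEmpty_descending_chain.2 ⟨fun ⟨b, hb⟩ => hadm ⟨b, hb⟩⟩

/-- Every path is equivalent modulo `ψ` to a combination of standard monomials that are not
larger. -/
theorem exists_normalForm (hlt : IsMonomialOrder lt) (hspan : PreferredBasisSpans ψ lt)
    (b : PathMon V) :
    ∃ z ∈ Submodule.span K ((mono : PathMon V → PathAlgebra K V) ''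
      {j | IsStd ψ lt j ∧ (j = b ∨ lt j b)}), ψ z = ψ (mono b) := by
  classical
  have := hlt.total
  by_cases hb : IsStd ψ lt b
  · exact ⟨mono b, Submodule.subset_span ⟨b, ⟨hb, Or.inl rfl⟩, rfl⟩, rfl⟩
  have hmem : ψ (mono b) ∈
      (Submodule.span K ((mono : PathMon V → PathAlgebra K V) '' {j | IsStd ψ lt j})).map
        ψ.toLinearMap := by
    rw [Submodule.map_span, ← Set.image_comp]
    have : (ψ.toLinearMap ∘ mono) '' {j | IsStd ψ lt j} =
        Set.range (monA : StdMon ψ lt → A) := by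
      rw [Set.image_eq_range]
      rfl
    rw [this, hspan]
    trivial
  obtain ⟨y, hy, hyb⟩ := hmem
  refine ⟨y, ?_, hyb⟩
  obtain ⟨q, hq, rfl⟩ := (Finsupp.mem_span_image_iff_linearCombination K).1 hy
  have hqstd : ∀ j, q j ≠ 0 → IsStd ψ lt j := fun j hj => hq (Finsupp.mem_support_iff.2 hj)
  have hqb : q b = 0 := by
    by_contra h
    exact hb (hqstd b h)
  have hpj : ∀ j, j ≠ b → (Finsupp.single b (1 : K) - q) j = - q j := by
    intro j hj
    simp [hj.symm]
  obtain ⟨i, hi, hmax⟩ := exists_max_support (lt := lt) (p := Finsupp.single b (1 : K) - q) (by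
    intro h
    have := DFunLike.congr_fun h b
    simp [hqb] at this)
  -- `b - q` lies in `ker ψ`, and all its paths other than `b` are standard, so only `b` can lead
  -- it. The bound on the support of `q` follows without any rewriting process.
  have hib : i = b := by
    by_contra hib
    rw [hpj i hib, neg_ne_zero] at hi
    refine hqstd i hi _ ?_ ⟨_, rfl, by rwa [hpj i hib, neg_ne_zero], hmax⟩
    rw [map_sub, Finsupp.linearCombination_single, one_smul, map_sub, sub_eq_zero]
    exact hyb.symm
  subst hib
  refine (Finsupp.mem_span_image_iff_linearCombination K).2 ⟨q, fun j hj => ?_, rfl⟩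
  have hj := Finsupp.mem_support_iff.1 hj
  have hji : j ≠ i := by
    rintro rfl
    exact hj hqb
  exact ⟨hqstd j hj, Or.inr (hmax j (by rwa [hpj j hji, neg_ne_zero]) hji)⟩

end StandardMonomials

/-! ### Orderings, multiplication and evaluation on the free modules -/

section FreeModules

variable {V : Type u} [Quiver.{v} V] [Fintype V] {K : Type w} [Field K] {A : Type x} [Ring A]
  [Algebra K A] {ψ : PathAlgebra K V →ₐ[K] A} {lt : PathMon V → PathMon V → Prop} {r m : ℕ}
  {ltF : Fin r × StdMon ψ lt → Fin r × StdMon ψ lt → Prop}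
  {ltE : Fin m × PathMon V → Fin m × PathMon V → Prop}

/-- By totality, `compat` also holds in the reverse direction, so each fibre of `ltF` inherits
well-foundedness from the admissible ordering of `A`. -/
theorem IsOrderF.wellFounded (hF : IsOrderF ltF) (hlt : IsMonomialOrder lt)
    (hadm : IsAdmissible ψ lt) : WellFounded ltF := by
  have := hlt.total
  have := hF.total
  refine wellFounded_fin_prod fun i => Subrelation.wf (fun {a b} h => ?_) (wellFounded_ltA hadm)
  rcases trichotomous_of ltA a b with h' | rfl | h'
  · exact h'
  · exact absurd h (irrefl_of ltF _)
  · exact absurd (hF.compat i _ _ h') (asymm_of ltF h)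

/-- The ordering of `E` is well-founded on the monomials that involve standard paths only. -/
theorem IsOrderE.wellFounded (hE : IsOrderE lt ltE) (hlt : IsMonomialOrder lt)
    (hadm : IsAdmissible ψ lt) :
    {s : Fin m × PathMon V | IsStd ψ lt s.2}.WellFoundedOn ltE := by
  have := hlt.total
  have := hE.total
  let φ : Fin m × StdMon ψ lt → Fin m × PathMon V := fun s => (s.1, s.2.1)
  have hφ : {s : Fin m × PathMon V | IsStd ψ lt s.2} = Set.range φ := by
    ext ⟨i, b⟩
    simp [φ]
  have hinj : Function.Injective φ := by
    rintro ⟨i, b⟩ ⟨j, c⟩ h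
    simpa [φ, Subtype.ext_iff] using h
  rw [hφ, Set.wellFoundedOn_range]
  have : IsStrictTotalOrder (Fin m × StdMon ψ lt) (Function.onFun ltE φ) :=
    { trichotomous := fun a b h h' => hinj (Std.Trichotomous.trichotomous (r := ltE) _ _ h h')
      irrefl := fun a => irrefl_of ltE (φ a)
      trans := fun _ _ _ h h' => trans_of ltE h h' }
  refine wellFounded_fin_prod fun i => Subrelation.wf (fun {a b} h => ?_) (wellFounded_ltA hadm)
  rcases trichotomous_of ltA a b with h' | rfl | h'
  · exact h'
  · exact absurd h (irrefl_of ltE _)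
  · exact absurd (hE.compat i _ _ h') (asymm_of ltE h)

/-- Multiplication with a small cofactor is compatible with leading monomials. -/
theorem IsLMF.mul (hF : IsOrderF ltF) (hlt : IsMonomialOrder lt)
    (hspan : PreferredBasisSpans ψ lt) {f : Fin r → A} {i : Fin r} {b c q : StdMon ψ lt}
    (h : IsLMF ltF f (i, b)) (hq : b.1.mul c.1 = some q.1) :
    IsLMF ltF (MulOpposite.op (monA c) • f) (i, q) := by
  have := hlt.total
  have := hF.total
  have hmul : ∀ (j : Fin r) (a : A), MulOpposite.op (monA c) • (Pi.single j a : Fin r → A) =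
      Pi.single j (a * monA c) := by
    intro j a
    ext k
    by_cases hk : k = j
    · subst hk
      simp
    · simp [hk]
  refine IsLM.map (DistribSMul.toLinearMap K (Fin r → A) (MulOpposite.op (monA c))) h ?_ ?_
  · rw [DistribSMul.toLinearMap_apply, monF, hmul, monA_mul_monA hq]
    exact isLM_mon (mon := monF) (i, q)
  · rintro ⟨j, d⟩ hj
    rw [DistribSMul.toLinearMap_apply, monF, hmul]
    by_cases h0 : monA d * monA c = 0
    · simp [h0]
    · obtain ⟨t, ht⟩ := exists_isLM_of_span_eq_top (K := K) (lt := ltA) (mon := (monA : StdMon ψ lt → A))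
        hspan h0
      -- A lower monomial times `c` need not be a monomial, but the order axiom bounds its leading
      -- monomial `t`, hence the whole product.
      have htq := hF.mul_lt_mul i j b d c q t ((isSmall_iff hlt hspan).2 ⟨q, hq⟩) hj hq ht
      have hle := IsLM.map (lt' := ltF) (mon' := monF) (i' := (j, t))
        (LinearMap.single K (fun _ : Fin r => A) j) ht
        (isLM_mon (mon := monF) (j, t))
        fun k hk => mon_mem_below (mon := monF) (j := (j, k)) (hF.compat j _ _ hk)
      exact hle.mem_below htq

/-- Right multiplication of elements of `E` with a path. -/
noncomputable def mulE (K : Type w) [Field K] (m : ℕ) (c : PathMon V) :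
    (Fin m → PathAlgebra K V) →ₗ[K] (Fin m → PathAlgebra K V) :=
  LinearMap.pi fun i => (LinearMap.mulRight K (mono c)) ∘ₗ LinearMap.proj i

theorem mulE_monE (c : PathMon V) (s : Fin m × PathMon V) :
    mulE K m c (monE K s) = Pi.single s.1 (mono? (s.2.mul c)) := by
  ext1 k
  by_cases hk : k = s.1
  · subst hk
    simp [mulE, monE, mono_mul_mono]
  · simp [mulE, monE, hk]

theorem mulE_monE_of_none {c : PathMon V} {s : Fin m × PathMon V} (h : sigMul s c = none) :
    mulE K m c (monE K s) = 0 := by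
  rw [sigMul, Option.map_eq_none_iff] at h
  rw [mulE_monE, h]
  simp [mono?]

omit [Fintype V] in
theorem sigMul_eq_some {c : PathMon V} {s s' : Fin m × PathMon V} :
    sigMul s c = some s' ↔ s'.1 = s.1 ∧ s.2.mul c = some s'.2 := by
  obtain ⟨i, b⟩ := s
  obtain ⟨j, b'⟩ := s'
  simp only [sigMul, Option.map_eq_some_iff, Prod.mk.injEq]
  constructor
  · rintro ⟨d, hd, rfl, rfl⟩
    exact ⟨rfl, hd⟩
  · rintro ⟨rfl, h⟩
    exact ⟨_, h, rfl, rfl⟩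

theorem mulE_monE_of_some {c : PathMon V} {s s' : Fin m × PathMon V}
    (h : sigMul s c = some s') : mulE K m c (monE K s) = monE K s' := by
  obtain ⟨h1, h2⟩ := sigMul_eq_some.1 h
  rw [mulE_monE, h2, ← h1]
  rfl

omit [Fintype V] in
theorem IsOrderE.sigMul_lt (hE : IsOrderE lt ltE) {c : PathMon V} {s s' t t' : Fin m × PathMon V}
    (hst : ltE s t) (hs : sigMul s c = some s') (ht : sigMul t c = some t') : ltE s' t' := by
  obtain ⟨h1, h2⟩ := sigMul_eq_some.1 hs
  obtain ⟨h3, h4⟩ := sigMul_eq_some.1 ht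
  have := hE.mul_lt_mul _ _ _ _ _ _ _ hst h4 h2
  rwa [← h1, ← h3] at this

-- Cancellation comes from totality. It serves to remove the last arrow of two signatures.
omit [Fintype V] in
theorem IsOrderE.lt_of_sigMul_lt (hE : IsOrderE lt ltE) {c : PathMon V}
    {s s' t t' : Fin m × PathMon V} (hst : ltE s' t') (hs : sigMul s c = some s')
    (ht : sigMul t c = some t') : ltE s t := by
  have := hE.total
  rcases trichotomous_of ltE s t with h | rfl | h
  · exact h
  · rw [Option.some.inj (hs.symm.trans ht)] at hst
    exact absurd hst (irrefl_of ltE _)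
  · exact absurd (hE.sigMul_lt h ht hs) (asymm_of ltE hst)

theorem mulE_mem_below (hE : IsOrderE lt ltE) {c : PathMon V} {s s' : Fin m × PathMon V}
    {z : Fin m → PathAlgebra K V} (hz : z ∈ below K ltE (monE K) s) (h : sigMul s c = some s') :
    mulE K m c z ∈ below K ltE (monE K) s' := by
  refine map_mem_below _ hz fun j hj => ?_
  rcases hjc : sigMul j c with _ | j'
  · simp [mulE_monE_of_none hjc]
  · rw [mulE_monE_of_some hjc]
    exact mon_mem_below (hE.sigMul_lt hj hjc h)

theorem IsLM.mulE (hE : IsOrderE lt ltE) {c : PathMon V} {s s' : Fin m × PathMon V}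
    {z : Fin m → PathAlgebra K V} (hz : IsLM K ltE (monE K) z s) (h : sigMul s c = some s') :
    IsLM K ltE (monE K) (mulE K m c z) s' := by
  have := hE.total
  refine hz.map _ ?_ fun j hj => mulE_mem_below hE (mon_mem_below hj) h
  rw [mulE_monE_of_some h]
  exact isLM_mon s'

/-- Right multiplication with the trivial path at `y` retains the monomials that end at `y`. -/
theorem mulE_triv_mem {y : V} {S : Set (Fin m × PathMon V)} {z : Fin m → PathAlgebra K V}
    (hz : z ∈ Submodule.span K (monE K '' S)) :
    mulE K m (PathMon.triv y) z ∈ Submodule.span K (monE K '' {j ∈ S | j.2.tgt = y}) := by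
  have : Submodule.span K (monE K '' S) ≤
      (Submodule.span K (monE K '' {j ∈ S | j.2.tgt = y})).comap (mulE K m (PathMon.triv y)) := by
    rw [Submodule.span_le]
    rintro _ ⟨j, hj, rfl⟩
    rw [SetLike.mem_coe, Submodule.mem_comap]
    by_cases hy : j.2.tgt = y
    · rw [mulE_monE_of_some (s' := j) (sigMul_eq_some.2 ⟨rfl, PathMon.mul_triv _ _ hy⟩)]
      exact Submodule.subset_span ⟨j, ⟨hj, hy⟩, rfl⟩
    · rw [mulE_monE_of_none]
      · exact zero_mem _
      · rw [sigMul, PathMon.mul_eq_none (by exact hy)]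
        rfl
  exact this hz

variable (ψ) in
/-- The evaluation map as a `K`-linear map. -/
noncomputable def evₗ (ghat : Fin m → Fin r → A) : (Fin m → PathAlgebra K V) →ₗ[K] (Fin r → A) where
  toFun := ev ψ ghat
  map_add' p q := by
    simp only [ev, Pi.add_apply, map_add, MulOpposite.op_add, add_smul, Finset.sum_add_distrib]
  map_smul' k p := by
    simp only [ev, Pi.smul_apply, map_smul, MulOpposite.op_smul, smul_assoc, Finset.smul_sum,
      RingHom.id_apply]

theorem evₗ_apply (ghat : Fin m → Fin r → A) (z : Fin m → PathAlgebra K V) :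
    evₗ ψ ghat z = ev ψ ghat z := rfl

theorem evₗ_mulE (ghat : Fin m → Fin r → A) (c : PathMon V) (z : Fin m → PathAlgebra K V) :
    evₗ ψ ghat (mulE K m c z) = MulOpposite.op (ψ (mono c)) • evₗ ψ ghat z := by
  simp [evₗ_apply, ev, mulE, Finset.smul_sum, mul_smul]

theorem evₗ_single (ghat : Fin m → Fin r → A) (i : Fin m) (p : PathAlgebra K V) :
    evₗ ψ ghat (Pi.single i p) = MulOpposite.op (ψ p) • ghat i := by
  rw [evₗ_apply, ev, Finset.sum_eq_single i]
  · simp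
  · intro j _ hj
    simp [hj]
  · simp

theorem evₗ_mem (ghat : Fin m → Fin r → A) (z : Fin m → PathAlgebra K V) :
    evₗ ψ ghat z ∈ Submodule.span Aᵐᵒᵖ (Set.range ghat) := by
  rw [evₗ_apply, ev]
  exact sum_mem fun i _ => Submodule.smul_mem _ _ (Submodule.subset_span (Set.mem_range_self i))

/-- In evaluating, one may restrict to monomials that involve standard paths only. -/
theorem exists_std_evₗ_eq (hlt : IsMonomialOrder lt) (hspan : PreferredBasisSpans ψ lt)
    (hE : IsOrderE lt ltE) (ghat : Fin m → Fin r → A) {s : Fin m × PathMon V}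
    {z : Fin m → PathAlgebra K V} (hz : z ∈ below K ltE (monE K) s) :
    ∃ z' ∈ Submodule.span K (monE K '' {j | ltE j s ∧ IsStd ψ lt j.2}),
      evₗ ψ ghat z' = evₗ ψ ghat z := by
  have := hE.total
  have : below K ltE (monE K) s ≤
      ((Submodule.span K (monE K '' {j | ltE j s ∧ IsStd ψ lt j.2})).map (evₗ ψ ghat)).comap
        (evₗ ψ ghat) := by
    rw [below, Submodule.span_le]
    rintro _ ⟨⟨i, b⟩, hj, rfl⟩
    -- Evaluation factors through `ψ`, and passing to the normal form of `b` does not raise the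
    -- signature.
    obtain ⟨y, hy, hyb⟩ := exists_normalForm hlt hspan b
    refine ⟨Pi.single i y, ?_, by rw [evₗ_single, monE, evₗ_single, hyb]⟩
    have hle : Submodule.span K ((mono : PathMon V → PathAlgebra K V) ''
        {j | IsStd ψ lt j ∧ (j = b ∨ lt j b)}) ≤
        (Submodule.span K (monE K '' {j | ltE j s ∧ IsStd ψ lt j.2})).comap
          (LinearMap.single K (fun _ : Fin m => PathAlgebra K V) i) := by
      rw [Submodule.span_le]
      rintro _ ⟨c, ⟨hc, hcb⟩, rfl⟩
      refine Submodule.subset_span ⟨(i, c), ⟨?_, hc⟩, rfl⟩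
      rcases hcb with rfl | hcb
      · exact hj
      · exact trans_of ltE (hE.compat i _ _ hcb) hj
    exact hle hy
  exact this hz

end FreeModules

/-! ### Reducibility, covered signatures and the two characterizations -/

section SignedElements

variable {V : Type u} [Quiver.{v} V] [Fintype V] {K : Type w} [Field K] {A : Type x} [Ring A]
  [Algebra K A] {ψ : PathAlgebra K V →ₐ[K] A} {lt : PathMon V → PathMon V → Prop} {r m : ℕ}
  {ltF : Fin r × StdMon ψ lt → Fin r × StdMon ψ lt → Prop}
  {ltE : Fin m × PathMon V → Fin m × PathMon V → Prop} {ghat : Fin m → Fin r → A}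
  {G : Set ((Fin r → A) × (Fin m × PathMon V))} {s : Fin m × PathMon V} {f f' : Fin r → A}
  {n n' : Fin r × StdMon ψ lt} {z : Fin m → PathAlgebra K V}

theorem IsLMF.unique (hlt : IsMonomialOrder lt) (hF : IsOrderF ltF) (h : IsLMF ltF f n)
    (h' : IsLMF ltF f n') : n = n' := by
  have := hF.total
  unfold IsLMF at h h'
  exact IsLM.unique (lt := ltF) (linearIndependent_monF (ψ := ψ) hlt) h h'

theorem IsLMF.ne_zero (hlt : IsMonomialOrder lt) (h : IsLMF ltF f n) : f ≠ 0 := by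
  unfold IsLMF at h
  exact IsLM.ne_zero (linearIndependent_monF (ψ := ψ) hlt) h

theorem exists_isLMF (hspan : PreferredBasisSpans ψ lt) (hF : IsOrderF ltF) (hf : f ≠ 0) :
    ∃ n, IsLMF ltF f n := by
  have := hF.total
  exact exists_isLM_of_span_eq_top (K := K) (mon := (monF : Fin r × StdMon ψ lt → Fin r → A))
    (span_monF hspan) hf

theorem SReducible.mono {G' : Set ((Fin r → A) × (Fin m × PathMon V))} (hG : G ⊆ G')
    (h : SReducible ltF ltE G s f) : SReducible ltF ltE G' s f := by
  obtain ⟨g, hg, h⟩ := h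
  exact ⟨g, hG hg, h⟩

theorem SReducible.of_isLMF (hlt : IsMonomialOrder lt) (hF : IsOrderF ltF)
    (h : SReducible ltF ltE G s f) (hf : IsLMF ltF f n) (hf' : IsLMF ltF f' n) :
    SReducible ltF ltE G s f' := by
  obtain ⟨g, hg, c, n', s', hn', h⟩ := h
  obtain rfl := hf.unique hlt hF hn'
  exact ⟨g, hg, c, n, s', hf', h⟩

theorem IsStd.triv_tgt (hlt : IsMonomialOrder lt) (b : StdMon ψ lt) :
    IsStd ψ lt (PathMon.triv b.1.tgt) :=
  b.2.of_mul_right hlt (PathMon.mul_triv _ _ rfl)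

/-- With the trivial cofactor, an element can itself serve as a reducer for everything with its
leading monomial. -/
theorem smallMulEq_triv (hlt : IsMonomialOrder lt) (hspan : PreferredBasisSpans ψ lt)
    (hf : IsLMF ltF f n) : SmallMulEq ltF f ⟨_, IsStd.triv_tgt hlt n.2⟩ n :=
  ⟨n.2, hf, (isSmall_iff hlt hspan).2 ⟨n.2, PathMon.mul_triv _ _ rfl⟩,
    PathMon.mul_triv _ _ rfl⟩

omit [Fintype V] in
theorem sigMul_triv {y : V} (h : s.2.tgt = y) : sigMul s (PathMon.triv y) = some s :=
  sigMul_eq_some.2 ⟨rfl, PathMon.mul_triv _ _ h⟩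

/-- An element whose leading monomial occurs in a smaller signature is reducible. -/
theorem sReducible_of_mem_below (hlt : IsMonomialOrder lt) (hspan : PreferredBasisSpans ψ lt)
    (hF : IsOrderF ltF) (hE : IsOrderE lt ltE) (hf : IsLMF ltF f n)
    (hz : z ∈ below K ltE (monE K) s) (hzn : IsLMF ltF (evₗ ψ ghat z) n) :
    SReducible ltF ltE
      (signedNonzero ψ ltE ghat (Submodule.span Aᵐᵒᵖ (Set.range ghat))) s f := by
  have := hE.total
  -- The signature of `z` may end at another vertex than `n`, and then its product with the trivial
  -- cofactor would be `0`. Multiplying `z` by the trivial path at the end of `n` keeps `n` and only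
  -- the monomials with the right end point.
  have hn : IsLMF ltF (evₗ ψ ghat (mulE K m (PathMon.triv n.2.1.tgt) z)) n := by
    rw [evₗ_mulE]
    exact IsLMF.mul hF hlt hspan (c := ⟨_, IsStd.triv_tgt hlt n.2⟩) hzn
      (PathMon.mul_triv _ _ rfl)
  obtain ⟨s', ⟨hs', hy⟩, hLM⟩ := exists_isLM_of_mem_span (lt := ltE)
    (mulE_triv_mem (y := n.2.1.tgt) hz) (by
      intro h
      rw [h, map_zero] at hn
      exact hn.ne_zero hlt rfl)
  exact ⟨(_, s'), ⟨⟨evₗ_mem _ _, _, hLM, rfl⟩, hn.ne_zero hlt⟩, _, n, s', hf,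
    smallMulEq_triv hlt hspan hn, sigMul_triv hy, hs'⟩

/-- Converse of `sReducible_of_mem_below`: reducibility with respect to all of `M \ {0}` just means
that the leading monomial is attained by evaluating an element of `E` strictly below `s`. -/
theorem SReducible.exists_mem_below (hlt : IsMonomialOrder lt)
    (hspan : PreferredBasisSpans ψ lt) (hF : IsOrderF ltF) (hE : IsOrderE lt ltE)
    {M : Submodule Aᵐᵒᵖ (Fin r → A)}
    (h : SReducible ltF ltE (signedNonzero ψ ltE ghat M) s f) (hf : IsLMF ltF f n) :
    ∃ z ∈ below K ltE (monE K) s, IsLMF ltF (evₗ ψ ghat z) n := by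
  have := hE.total
  obtain ⟨⟨g, t⟩, ⟨⟨-, p, hp, hpg⟩, -⟩, c, n', s', hn', ⟨b, hgb, -, hbc⟩, hs', hlt'⟩ := h
  obtain rfl := hf.unique hlt hF hn'
  refine ⟨mulE K m c.1 p, (hp.mulE hE hs').mem_below hlt', ?_⟩
  rw [evₗ_mulE, evₗ_apply, hpg]
  exact IsLMF.mul hF hlt hspan hgb hbc

/-- Subtracting a multiple of a kernel element led by `s` would keep the evaluation but lower the
signature, so the evaluation would reduce itself. -/
theorem not_isKerLM_of_not_sReducible (hlt : IsMonomialOrder lt)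
    (hspan : PreferredBasisSpans ψ lt) (hF : IsOrderF ltF) (hE : IsOrderE lt ltE)
    (hz : IsLM K ltE (monE K) z s) (h0 : evₗ ψ ghat z ≠ 0)
    (h : ¬ SReducible ltF ltE
      (signedNonzero ψ ltE ghat (Submodule.span Aᵐᵒᵖ (Set.range ghat))) s (evₗ ψ ghat z)) :
    ¬ IsKerLM ψ ltE ghat s := by
  have := hE.total
  rintro ⟨y, hy, hys⟩
  obtain ⟨k, -, hk⟩ := hz.exists_sub_smul_mem_below hys
  obtain ⟨n, hn⟩ := exists_isLMF hspan hF h0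
  refine h (sReducible_of_mem_below hlt hspan hF hE hn hk ?_)
  rwa [map_sub, map_smul, evₗ_apply ghat y, hy, smul_zero, sub_zero]

theorem IsKerLM.sigMul (hE : IsOrderE lt ltE) {c : PathMon V} {s' : Fin m × PathMon V}
    (h : IsKerLM ψ ltE ghat s) (hs : sigMul s c = some s') : IsKerLM ψ ltE ghat s' := by
  obtain ⟨z, hz, hzs⟩ := h
  refine ⟨mulE K m c z, ?_, hzs.mulE hE hs⟩
  rw [← evₗ_apply, evₗ_mulE, evₗ_apply, hz, smul_zero]

/-- If `z ∈ ker ψ` then `e_i z ∈ ker ev`. This brings the relevant signatures into the range where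
`ltE` is well-founded. -/
theorem isStd_of_not_isKerLM (hlt : IsMonomialOrder lt) (hE : IsOrderE lt ltE)
    (h : ¬ IsKerLM ψ ltE ghat s) : IsStd ψ lt s.2 := by
  have := hlt.total
  have := hE.total
  intro z hz hLM
  refine h ⟨Pi.single s.1 z, ?_, ?_⟩
  · rw [← evₗ_apply, evₗ_single, hz, MulOpposite.op_zero, zero_smul]
  · exact hLM.map (LinearMap.single K (fun _ : Fin m => PathAlgebra K V) s.1)
      (isLM_mon (mon := monE K) s)
      fun j hj => mon_mem_below (mon := monE K) (j := (s.1, j)) (hE.compat s.1 _ _ hj)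

/-- If the leading monomial of a combination of signature less than `s` is given, then it is the
leading monomial of a signed element of smaller signature that is irreducible. -/
theorem exists_irreducible_lt (hlt : IsMonomialOrder lt) (hspan : PreferredBasisSpans ψ lt)
    (hadm : IsAdmissible ψ lt) (hF : IsOrderF ltF) (hE : IsOrderE lt ltE)
    (hz : z ∈ below K ltE (monE K) s) (hn : IsLMF ltF (evₗ ψ ghat z) n) :
    ∃ y t, IsLM K ltE (monE K) y t ∧ ltE t s ∧ IsStd ψ lt t.2 ∧ IsLMF ltF (evₗ ψ ghat y) n ∧
      ¬ SReducible ltF ltE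
        (signedNonzero ψ ltE ghat (Submodule.span Aᵐᵒᵖ (Set.range ghat))) t (evₗ ψ ghat y) := by
  have := hE.total
  -- Rewriting by normal forms before choosing a signature keeps every step of the descent among
  -- standard paths.
  have hdown : ∀ (t : Fin m × PathMon V) (z : Fin m → PathAlgebra K V),
      z ∈ below K ltE (monE K) t → IsLMF ltF (evₗ ψ ghat z) n →
      ∃ t', ltE t' t ∧ IsStd ψ lt t'.2 ∧
        ∃ y, IsLM K ltE (monE K) y t' ∧ IsLMF ltF (evₗ ψ ghat y) n := by
    intro t z hz hn
    obtain ⟨y, hy, hyz⟩ := exists_std_evₗ_eq hlt hspan hE ghat hz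
    rw [← hyz] at hn
    obtain ⟨t', ⟨ht', hstd⟩, hLM⟩ := exists_isLM_of_mem_span (lt := ltE) hy (by
      rintro rfl
      rw [map_zero] at hn
      exact hn.ne_zero hlt rfl)
    exact ⟨t', ht', hstd, y, hLM, hn⟩
  have hwf := hE.wellFounded (ψ := ψ) hlt hadm
  have hmin : ∀ t : Fin m × PathMon V, IsStd ψ lt t.2 → ltE t s →
      (∃ y, IsLM K ltE (monE K) y t ∧ IsLMF ltF (evₗ ψ ghat y) n) →
      ∃ y t, IsLM K ltE (monE K) y t ∧ ltE t s ∧ IsStd ψ lt t.2 ∧ IsLMF ltF (evₗ ψ ghat y) n ∧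
      ¬ SReducible ltF ltE
        (signedNonzero ψ ltE ghat (Submodule.span Aᵐᵒᵖ (Set.range ghat))) t (evₗ ψ ghat y) := by
    intro t ht
    refine hwf.induction (P := fun t => ltE t s →
      (∃ y, IsLM K ltE (monE K) y t ∧ IsLMF ltF (evₗ ψ ghat y) n) → _) ht ?_
    rintro t ht ih hts ⟨y, hy, hyn⟩
    by_cases hred : SReducible ltF ltE
        (signedNonzero ψ ltE ghat (Submodule.span Aᵐᵒᵖ (Set.range ghat))) t (evₗ ψ ghat y)
    · obtain ⟨z', hz', hn'⟩ := hred.exists_mem_below hlt hspan hF hE hyn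
      obtain ⟨t', ht', hstd, hy'⟩ := hdown t z' hz' hn'
      exact ih t' hstd ht' (trans_of ltE ht' hts) hy'
    · exact ⟨y, t, hy, hts, ht, hyn, hred⟩
  obtain ⟨t, hts, hstd, hy⟩ := hdown s z hz hn
  exact hmin t hstd hts hy

/-- Every monomial of `E` that does not lead an element of `ker ev` is the signature of an
irreducible element. -/
theorem exists_irreducible_of_not_isKerLM (hlt : IsMonomialOrder lt)
    (hspan : PreferredBasisSpans ψ lt) (hadm : IsAdmissible ψ lt) (hF : IsOrderF ltF)
    (hE : IsOrderE lt ltE) (hs : ¬ IsKerLM ψ ltE ghat s) :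
    ∃ z, IsLM K ltE (monE K) z s ∧ evₗ ψ ghat z ≠ 0 ∧ ¬ SReducible ltF ltE
      (signedNonzero ψ ltE ghat (Submodule.span Aᵐᵒᵖ (Set.range ghat))) s (evₗ ψ ghat z) := by
  have := hE.total
  have := hF.total
  have h0 : ∀ z, IsLM K ltE (monE K) z s → evₗ ψ ghat z ≠ 0 := fun z hz h => hs ⟨z, h, hz⟩
  have hmin : ∀ n : Fin r × StdMon ψ lt, ∀ z, IsLM K ltE (monE K) z s →
      IsLMF ltF (evₗ ψ ghat z) n →
      ∃ z, IsLM K ltE (monE K) z s ∧ evₗ ψ ghat z ≠ 0 ∧ ¬ SReducible ltF ltE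
        (signedNonzero ψ ltE ghat (Submodule.span Aᵐᵒᵖ (Set.range ghat))) s (evₗ ψ ghat z) := by
    intro n
    induction n using (hF.wellFounded hlt hadm).induction with
    | _ n ih =>
      intro z hz hn
      by_cases hred : SReducible ltF ltE
        (signedNonzero ψ ltE ghat (Submodule.span Aᵐᵒᵖ (Set.range ghat))) s (evₗ ψ ghat z)
      · obtain ⟨y, hy, hyn⟩ := hred.exists_mem_below hlt hspan hF hE hn
        -- The reduction step: the signature `s` survives since `y` is below it, the leading
        -- monomial in `F` drops, and the result is non-zero since `s` leads no kernel element.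
        obtain ⟨k, -, hk⟩ := IsLM.exists_sub_smul_mem_below hn hyn
        have hz' := hz.sub_mem_below (Submodule.smul_mem _ k hy)
        rw [← map_smul, ← map_sub] at hk
        obtain ⟨n', hn', hLM⟩ := exists_isLM_of_mem_below hk (h0 _ hz')
        exact ih n' hn' _ hz' hLM
      · exact ⟨z, hz, h0 z hz, hred⟩
  obtain ⟨n, hn⟩ := exists_isLMF hspan hF (h0 _ (isLM_mon (mon := monE K) s))
  exact hmin n _ (isLM_mon (mon := monE K) s) hn

/-- The signatures that do not belong to `ker ev` are covered by a signed standard basis. -/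
theorem IsSignedStandardBasis.isCovered (hlt : IsMonomialOrder lt)
    (hspan : PreferredBasisSpans ψ lt) (hadm : IsAdmissible ψ lt) (hF : IsOrderF ltF)
    (hE : IsOrderE lt ltE)
    (hG : G ⊆ signedNonzero ψ ltE ghat (Submodule.span Aᵐᵒᵖ (Set.range ghat)))
    (h : IsSignedStandardBasis ltF ltE ghat (Submodule.span Aᵐᵒᵖ (Set.range ghat)) G)
    (hs : ¬ IsKerLM ψ ltE ghat s) : IsCovered ltF ltE G s := by
  obtain ⟨z, hz, h0, hred⟩ := exists_irreducible_of_not_isKerLM hlt hspan hadm hF hE hs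
  obtain ⟨g, hg, c, n, s', hn, ⟨b, hgb, hbc, hbn⟩, hs', hlt' | rfl⟩ :=
    h (evₗ ψ ghat z, s) ⟨⟨evₗ_mem _ _, z, hz, rfl⟩, h0⟩ (Or.inr hred)
  · exact absurd ⟨g, hG hg, c, n, s', hn, ⟨b, hgb, hbc, hbn⟩, hs', hlt'⟩ hred
  · refine ⟨g, hg, c, (n.1, b), hgb, hbc, hs', Or.inr fun hred' => hred ?_⟩
    exact (hred'.of_isLMF hlt hF (IsLMF.mul hF hlt hspan hgb hbn) hn).mono hG

/-- Under the `F5` criterion, all signatures that do not belong to `ker ev` are covered. -/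
theorem SatisfiesF5.isCovered (hlt : IsMonomialOrder lt) (hspan : PreferredBasisSpans ψ lt)
    (hF : IsOrderF ltF) (hE : IsOrderE lt ltE)
    (hG : G ⊆ signedNonzero ψ ltE ghat (Submodule.span Aᵐᵒᵖ (Set.range ghat)))
    (hirr : ∀ g ∈ G, SIrreducible ltF ltE G g.2 g.1)
    (hgen : ∀ (i : Fin m) (a : V), ¬ IsKerLM ψ ltE ghat (i, PathMon.triv a) →
      ∃ g ∈ G, g.2 = (i, PathMon.triv a))
    (h : SatisfiesF5 ltF ltE ghat G) (hs : ¬ IsKerLM ψ ltE ghat s) :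
    IsCovered ltF ltE G s := by
  obtain ⟨i, a, y, p⟩ := s
  induction p with
  | nil =>
    obtain ⟨g, hg, hgs⟩ := hgen i a hs
    obtain ⟨n, hn⟩ := exists_isLMF hspan hF (hG hg).2
    let c : StdMon ψ lt := ⟨PathMon.triv a, isStd_of_not_isKerLM hlt hE hs⟩
    have hgc : sigMul g.2 c.1 = some (i, PathMon.triv a) := by
      rw [hgs]
      exact sigMul_triv rfl
    -- `LM(g)` may end at a vertex other than `a`; then `1_a` is not a small cofactor, and `(g,
    -- 1_a)` is a pair of type T.
    by_cases hc : IsSmall n.2 c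
    · refine ⟨g, hg, c, n, hn, hc, hgc, ?_⟩
      obtain ⟨q, hq⟩ := (isSmall_iff hlt hspan).1 hc
      obtain rfl : n.2 = q := Subtype.ext (PathMon.mul_triv_eq hq)
      have hmul := IsLMF.mul hF hlt hspan hn hq
      refine Or.inr fun hred => ((hirr g hg).resolve_left (hn.ne_zero hlt)) ?_
      rw [hgs]
      exact hred.of_isLMF hlt hF hmul hn
    · obtain ⟨t, ht⟩ := not_not.1 hc
      refine h.1 g c _ ⟨⟨hg, n, hn, t, ht, fun c' ⟨d, hd⟩ hne => ?_⟩, hirr g hg, hgc, hs⟩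
      exact absurd (Subtype.ext (PathMon.eq_triv_of_mul hd).1) hne
  | @cons y w p e ih =>
    have hsig : sigMul ((i, ⟨a, y, p⟩) : Fin m × PathMon V) (PathMon.arrow e) =
        some (i, ⟨a, w, p.cons e⟩) :=
      sigMul_eq_some.2 ⟨rfl, PathMon.mk_mul_arrow p e⟩
    obtain ⟨g, hg, c, n, hn, hc, hgc, hcirr⟩ := ih fun hk => hs (hk.sigMul hE hsig)
    have hgc' := sigMul_eq_some.1 hgc
    obtain ⟨d, hd, hgd⟩ := PathMon.mul_mul_of_left hgc'.2 (PathMon.mk_mul_arrow p e)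
    -- `d = ce` is a final segment of the path in `s`, which is standard.
    have hdstd : IsStd ψ lt d := (isStd_of_not_isKerLM hlt hE hs).of_mul_right hlt hgd
    have hgd' : sigMul g.2 d = some (i, ⟨a, w, p.cons e⟩) :=
      sigMul_eq_some.2 ⟨hgc'.1, hgd⟩
    obtain ⟨q, hq⟩ := (isSmall_iff hlt hspan).1 hc
    by_cases hsmall : IsSmall n.2 ⟨d, hdstd⟩
    · by_contra hcov
      obtain ⟨q', hq'⟩ := (isSmall_iff hlt hspan).1 hsmall
      have hLM := IsLMF.mul hF hlt hspan hn hq'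
      have hqe : q.1.mul (PathMon.arrow e) = some q'.1 := by
        obtain ⟨q₁, hq₁, hq₂⟩ := PathMon.mul_mul_of_right hd hq'
        rwa [Option.some.inj (hq.symm.trans hq₁)]
      by_cases hred : SReducible ltF ltE G (i, ⟨a, w, p.cons e⟩)
        (MulOpposite.op (monA (⟨d, hdstd⟩ : StdMon ψ lt)) • g.1)
      · obtain ⟨g', hg', c', n', s', hn', ⟨b, hb, hbc', hbn⟩, hs', hss'⟩ := hred
        obtain rfl := hLM.unique hlt hF hn'
        -- A trivial `c'` means `LM(g') = LM(g)d`, a pair of type S. Otherwise `c' = c''e` with the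
        -- same last arrow, and cancelling `e` contradicts the irreducibility of `poly(g)c`.
        rcases PathMon.eq_triv_or_mul_arrow c'.1 with ⟨x, hx⟩ | ⟨c'', _, _, e', hc''⟩
        · rw [hx] at hbn hs'
          obtain rfl : b = q' := Subtype.ext (PathMon.mul_triv_eq hbn)
          have hs'' := sigMul_eq_some.1 hs'
          obtain rfl : g'.2 = s' := Prod.ext hs''.1.symm (PathMon.mul_triv_eq hs''.2)
          exact hcov (h.2 g g' ⟨d, hdstd⟩ _ ⟨⟨hg, hg', ⟨_, hb, n.2, hn, hsmall, hq'⟩, _, hgd',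
            hss'⟩, hirr g hg, hirr g' hg', hgd', hs⟩)
        · obtain ⟨q₁, hq₁, hq₂⟩ := PathMon.mul_mul_of_right hc'' hbn
          obtain ⟨rfl, he⟩ := PathMon.mul_arrow_inj hqe hq₂
          have hs'' := sigMul_eq_some.1 hs'
          obtain ⟨t, ht, ht'⟩ := PathMon.mul_mul_of_right hc'' hs''.2
          have hc''std : IsStd ψ lt c'' := c'.2.of_mul_left hlt hc''
          have hsig' : sigMul (g'.2.1, t) (PathMon.arrow e) = some s' :=
            sigMul_eq_some.2 ⟨hs''.1, by rw [he]; exact ht'⟩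
          have hcLM := IsLMF.mul hF hlt hspan hn hq
          exact hcirr.resolve_left (hcLM.ne_zero hlt) ⟨g', hg', ⟨c'', hc''std⟩, (n.1, q),
            (g'.2.1, t), hcLM, ⟨b, hb, (isSmall_iff hlt hspan).2 ⟨q, hq₁⟩, hq₁⟩,
            sigMul_eq_some.2 ⟨rfl, ht⟩, hE.lt_of_sigMul_lt hss' hsig' hsig⟩
      · exact hcov ⟨g, hg, ⟨d, hdstd⟩, n, hn, hsmall, hgd', Or.inr hred⟩
    -- The toppling is minimal: a proper initial segment of `d = ce` is an initial segment of the
    -- small cofactor `c`, hence small.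
    · obtain ⟨t, ht⟩ := not_not.1 hsmall
      refine h.1 g ⟨d, hdstd⟩ _ ⟨⟨hg, n, hn, t, ht, fun c' ⟨d', hd'⟩ hne => ?_⟩, hirr g hg,
        hgd', hs⟩
      obtain ⟨t', ht'⟩ := PathMon.exists_mul_of_mul_arrow hd hd' fun h => hne (Subtype.ext h)
      obtain ⟨q₁, hq₁, hq₂⟩ := PathMon.mul_mul_of_right ht' hq
      exact (isSmall_iff hlt hspan).2 ⟨⟨q₁, q.2.of_mul_left hlt hq₂⟩, hq₁⟩

/-- If all signatures that do not belong to `ker ev` are covered, then `G` is a signed standard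
basis. -/
theorem isSignedStandardBasis_of_isCovered (hlt : IsMonomialOrder lt)
    (hspan : PreferredBasisSpans ψ lt) (hadm : IsAdmissible ψ lt) (hF : IsOrderF ltF)
    (hE : IsOrderE lt ltE)
    (hG : G ⊆ signedNonzero ψ ltE ghat (Submodule.span Aᵐᵒᵖ (Set.range ghat)))
    (hcov : ∀ s, ¬ IsKerLM ψ ltE ghat s → IsCovered ltF ltE G s) :
    IsSignedStandardBasis ltF ltE ghat (Submodule.span Aᵐᵒᵖ (Set.range ghat)) G := by
  have := hE.total
  have := hF.total
  have key : ∀ s : Fin m × PathMon V, IsStd ψ lt s.2 → ∀ z, IsLM K ltE (monE K) z s →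
      evₗ ψ ghat z ≠ 0 → ¬ SReducible ltF ltE
        (signedNonzero ψ ltE ghat (Submodule.span Aᵐᵒᵖ (Set.range ghat))) s (evₗ ψ ghat z) →
      WeaklySReducible ltF ltE G s (evₗ ψ ghat z) := by
    intro s hstd
    refine (hE.wellFounded (ψ := ψ) hlt hadm).induction (P := fun s => ∀ z,
      IsLM K ltE (monE K) z s → evₗ ψ ghat z ≠ 0 → ¬ SReducible ltF ltE
        (signedNonzero ψ ltE ghat (Submodule.span Aᵐᵒᵖ (Set.range ghat))) s (evₗ ψ ghat z) →
      WeaklySReducible ltF ltE G s (evₗ ψ ghat z)) hstd ?_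
    intro s _ ih z hz h0 hred
    obtain ⟨h, hh, e, n, hn, he, hs, hirr⟩ :=
      hcov s (not_isKerLM_of_not_sReducible hlt hspan hF hE hz h0 hred)
    obtain ⟨q, hq⟩ := (isSmall_iff hlt hspan).1 he
    have hhe := IsLMF.mul hF hlt hspan hn hq
    obtain ⟨n', hn'⟩ := exists_isLMF hspan hF h0
    obtain ⟨⟨-, p, hp, hph⟩, -⟩ := hG hh
    have hev : evₗ ψ ghat (mulE K m e.1 p) = MulOpposite.op (monA e) • h.1 := by
      rw [evₗ_mulE, evₗ_apply, hph]
      rfl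
    -- Cancelling leading terms in `E` gives a difference of signature below `s`; its leading
    -- monomial in `F` is the larger of the two unless they coincide.
    obtain ⟨k, hk, hdiff⟩ := hz.exists_sub_smul_mem_below (hp.mulE hE hs)
    have hevd : evₗ ψ ghat (z - k • mulE K m e.1 p) =
        evₗ ψ ghat z - k • (MulOpposite.op (monA e) • h.1) := by
      rw [map_sub, map_smul, hev]
    have hhk : IsLMF ltF (k • (MulOpposite.op (monA e) • h.1)) (n.1, q) := IsLM.smul hk hhe
    rcases trichotomous_of ltF (n.1, q) n' with hlt' | rfl | hlt'
    -- The difference has the leading monomial of `f` in a smaller signature, against the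
    -- irreducibility of `f`.
    · refine absurd (sReducible_of_mem_below hlt hspan hF hE hn' hdiff ?_) hred
      rw [hevd]
      exact IsLM.sub_mem_below hn' (IsLM.mem_below hhk hlt')
    · exact ⟨h, hh, e, (n.1, q), s, hn', ⟨n.2, hn, he, hq⟩, hs, Or.inr rfl⟩
    -- Now the difference has the leading monomial of `poly(h)e`. An irreducible element of
    -- signature `t < s` with this leading monomial is weakly reducible by induction, so `poly(h)e`
    -- is `s`-reducible with respect to `G`, against `hirr`.
    · have hLM : IsLMF ltF (evₗ ψ ghat (z - k • mulE K m e.1 p)) (n.1, q) := by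
        rw [hevd, ← neg_sub, ← neg_one_smul K]
        exact IsLM.smul (neg_ne_zero.2 one_ne_zero)
          (IsLM.sub_mem_below hhk (IsLM.mem_below hn' hlt'))
      obtain ⟨y, t, hy, hts, ht, hyn, hyred⟩ :=
        exists_irreducible_lt hlt hspan hadm hF hE hdiff hLM
      obtain ⟨g, hg, c, n'', s', hn'', hsm, hs', hle⟩ :=
        ih t ht hts y hy (hyn.ne_zero hlt) hyred
      obtain rfl := hyn.unique hlt hF hn''
      refine absurd ⟨g, hg, c, _, s', hhe, hsm, hs', ?_⟩ (hirr.resolve_left (hhe.ne_zero hlt))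
      rcases hle with hle | rfl
      · exact trans_of ltE hle hts
      · exact hts
  rintro ⟨f, s⟩ ⟨⟨-, z, hz, rfl⟩, h0⟩ hirr
  have hred := hirr.resolve_left h0
  exact key s (isStd_of_not_isKerLM hlt hE
    (not_isKerLM_of_not_sReducible hlt hspan hF hE hz h0 hred)) z hz h0 hred

end SignedElements

end SignedSB

/-! ### The main theorem -/

theorem mainTheorem1
    {V : Type*} [Quiver V] [Fintype V] [∀ a b : V, Finite (a ⟶ b)]
    {K : Type*} [Field K] {A : Type*} [Ring A] [Algebra K A]
    (ψ : PathAlgebra K V →ₐ[K] A) (hψ : Function.Surjective ψ)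
    (lt : PathMon V → PathMon V → Prop) (hlt : IsMonomialOrder lt)
    (hspan : PreferredBasisSpans ψ lt) (hadm : IsAdmissible ψ lt)
    {r m : ℕ}
    (ltF : Fin r × StdMon ψ lt → Fin r × StdMon ψ lt → Prop) (hltF : IsOrderF ltF)
    (ltE : Fin m × PathMon V → Fin m × PathMon V → Prop) (hltE : IsOrderE lt ltE)
    (ghat : Fin m → Fin r → A) (M : Submodule Aᵐᵒᵖ (Fin r → A))
    (hM : M = Submodule.span Aᵐᵒᵖ (Set.range ghat))
    (G : Set ((Fin r → A) × (Fin m × PathMon V))) (hGfin : G.Finite)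
    (hG : G ⊆ signedNonzero ψ ltE ghat M)
    (hGred : IsInterreduced ltF ltE G)
    (hgen : ∀ (i : Fin m) (a : V), ¬ IsKerLM ψ ltE ghat (i, PathMon.triv a) →
      ∃ g ∈ G, g.2 = (i, PathMon.triv a)) :
    IsSignedStandardBasis ltF ltE ghat M G ↔ SatisfiesF5 ltF ltE ghat G := by
  subst hM
  constructor
  · intro h
    exact ⟨fun _ _ _ hn => h.isCovered hlt hspan hadm hltF hltE hG hn.2.2.2,
      fun _ _ _ _ hn => h.isCovered hlt hspan hadm hltF hltE hG hn.2.2.2.2⟩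
  · intro h
    exact isSignedStandardBasis_of_isCovered hlt hspan hadm hltF hltE hG fun s hs =>
      h.isCovered hlt hspan hltF hltE hG hGred.1 hgen hs
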